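/- Consider the bipartite spin glass with parties $\sigma\in\{-1,1\}^{N_1}$, $\tau\in\{-1,1\}^{N_2}$ and Hamiltonian $$H_{N_1,N_2}(\sigma,\tau)=-\sqrt{\frac{2}{N_1+N_2}}\sum_{i=1}^{N_1}\sum_{j=1}^{N_2}\xi_{ij}\sigma_i\tau_j ,$$ where the couplings $\xi_{ij}$ are i.i.d. standard Gaussian random variables. For $\beta\ge 0$ and fixed $\xi$ let $\omega$ be the Boltzmann state, which gives $(\sigma,\tau)$ the weight $e^{-\beta H_{N_1,N_2}(\sigma,\tau)}/\sum_{\sigma',\tau'}e^{-\beta H_{N_1,N_2}(\sigma',\tau')}$, let $\Omega=\omega\times\dots\times\omega$ be the product state of finitely many replicas $(\sigma^a,\tau^a)$, $a=1,2,\dots$, with the same couplings $\xi$, and let $\langle F\rangle=\mathbb E_\xi\,\Omega(F)$ for an observable $F$ of the replicas. (These averages depend on $N_1,N_2,\beta$.) The overlaps are $$q_{ab}=\frac1{N_1}\sum_{i=1}^{N_1}\sigma^a_i\sigma^b_i,\qquad p_{ab}=\frac1{N_2}\sum_{j=1}^{N_2}\tau^a_j\tau^b_j .$$ **Proposition.**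 In the thermodynamic limit and in $\beta$-average, the quadratic Ghirlanda–Guerra relations hold. That is, for every $\alpha\in(0,1)$, every sequence of sizes with $N_1\to\infty$, $N_2\to\infty$ and $N_1/(N_1+N_2)\to\alpha$, and all $0\le\beta_1\le\beta_2$, $$\lim\int_{\beta_1}^{\beta_2}\Big|\langle q_{12}p_{12}q_{23}p_{23}\rangle-\tfrac12\langle q_{12}^2p_{12}^2\rangle-\tfrac12\langle q_{12}p_{12}\rangle^2\Big|\,d\beta=0,$$ $$\lim\int_{\beta_1}^{\beta_2}\Big|\langle q_{12}p_{12}q_{34}p_{34}\rangle-\tfrac13\langle q_{12}^2p_{12}^2\rangle-\tfrac23\langle q_{12}p_{12}\rangle^2\Big|\,d\beta=0,$$ where the limits are taken along the given sequence of sizes. -/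

import Mathlib

open MeasureTheory ProbabilityTheory Filter Topology

noncomputable section

namespace BipartiteSpinGlass

/-- A configuration `(σ, τ)` of the two parties: `N₁` spins `σ_i = ±1` and `N₂` spins `τ_j = ±1`. -/
abbrev Config (N₁ N₂ : ℕ) : Type := (Fin N₁ → ℤˣ) × (Fin N₂ → ℤˣ)

/-- A realization `ξ_{ij}` of the couplings. -/
abbrev Disorder (N₁ N₂ : ℕ) : Type := Fin N₁ × Fin N₂ → ℝ

/-- The law of the quenched disorder: i.i.d. standard Gaussian couplings. -/
def disorderLaw (N₁ N₂ : ℕ) : Measure (Disorder N₁ N₂) :=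
  Measure.pi fun _ => gaussianReal 0 1

/-- The real value `±1` of a spin. -/
def spin (s : ℤˣ) : ℝ := ((s : ℤ) : ℝ)

/-- `H(σ, τ) = - √(2 / (N₁ + N₂)) ∑_{i,j} ξ_{ij} σ_i τ_j`. -/
def hamiltonian {N₁ N₂ : ℕ} (ξ : Disorder N₁ N₂) (x : Config N₁ N₂) : ℝ :=
  -√(2 / ((N₁ : ℝ) + (N₂ : ℝ))) *
    ∑ i : Fin N₁, ∑ j : Fin N₂, ξ (i, j) * spin (x.1 i) * spin (x.2 j)

/-- `Z(β) = ∑_{σ,τ} exp (-β H(σ, τ))`. -/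
def partitionFunction {N₁ N₂ : ℕ} (β : ℝ) (ξ : Disorder N₁ N₂) : ℝ :=
  ∑ x : Config N₁ N₂, Real.exp (-β * hamiltonian ξ x)

/-- The Boltzmann weight `exp (-β H(x)) / Z(β)` of a configuration. -/
def boltzmannWeight {N₁ N₂ : ℕ} (β : ℝ) (ξ : Disorder N₁ N₂) (x : Config N₁ N₂) : ℝ :=
  Real.exp (-β * hamiltonian ξ x) / partitionFunction β ξ

/-- The Boltzmann product state `Ω = ω × ⋯ × ω` of `s` replicas, which share the same disorder `ξ`,
applied to an observable `F` of the replicas. -/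
def productState {N₁ N₂ s : ℕ} (β : ℝ) (ξ : Disorder N₁ N₂)
    (F : (Fin s → Config N₁ N₂) → ℝ) : ℝ :=
  ∑ X : Fin s → Config N₁ N₂, (∏ a, boltzmannWeight β ξ (X a)) * F X

/-- The quenched average `⟨F⟩ = 𝔼_ξ Ω(F)` at inverse temperature `β`. -/
def quenchedAverage {N₁ N₂ s : ℕ} (β : ℝ) (F : (Fin s → Config N₁ N₂) → ℝ) : ℝ :=
  ∫ ξ, productState β ξ F ∂(disorderLaw N₁ N₂)

/-- `q_{ab} = N₁⁻¹ ∑_i σ_i^a σ_i^b`. -/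
def overlapQ {N₁ N₂ s : ℕ} (a b : Fin s) (X : Fin s → Config N₁ N₂) : ℝ :=
  (∑ i : Fin N₁, spin ((X a).1 i) * spin ((X b).1 i)) / (N₁ : ℝ)

/-- `p_{ab} = N₂⁻¹ ∑_j τ_j^a τ_j^b`. -/
def overlapP {N₁ N₂ s : ℕ} (a b : Fin s) (X : Fin s → Config N₁ N₂) : ℝ :=
  (∑ j : Fin N₂, spin ((X a).2 j) * spin ((X b).2 j)) / (N₂ : ℝ)

/-- `⟨q₁₂ p₁₂⟩` (replicas are numbered from `0` in the code). -/
def avgQP (N₁ N₂ : ℕ) (β : ℝ) : ℝ :=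
  quenchedAverage β fun X : Fin 2 → Config N₁ N₂ => overlapQ 0 1 X * overlapP 0 1 X

/-- `⟨q₁₂² p₁₂²⟩`. -/
def avgQPsq (N₁ N₂ : ℕ) (β : ℝ) : ℝ :=
  quenchedAverage β fun X : Fin 2 → Config N₁ N₂ => overlapQ 0 1 X ^ 2 * overlapP 0 1 X ^ 2

/-- `⟨q₁₂ p₁₂ q₂₃ p₂₃⟩`. -/
def avgQP12QP23 (N₁ N₂ : ℕ) (β : ℝ) : ℝ :=
  quenchedAverage β fun X : Fin 3 → Config N₁ N₂ =>
    overlapQ 0 1 X * overlapP 0 1 X * overlapQ 1 2 X * overlapP 1 2 X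

/-- `⟨q₁₂ p₁₂ q₃₄ p₃₄⟩`. -/
def avgQP12QP34 (N₁ N₂ : ℕ) (β : ℝ) : ℝ :=
  quenchedAverage β fun X : Fin 4 → Config N₁ N₂ =>
    overlapQ 0 1 X * overlapP 0 1 X * overlapQ 2 3 X * overlapP 2 3 X

end BipartiteSpinGlass

end

open BipartiteSpinGlass

/-! The energy `-H` is a centred Gaussian process on configurations with covariance `c * R`, where
`R = q p` is the product of overlaps, equal to `1` on the diagonal, and `c = 2 N₁ N₂ / (N₁ + N₂)`
tends to infinity. The argument applies to any finite Gibbs measure whose energy has such a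
covariance.

Gaussian integration by parts (`integral_replicas_energy_mul`) turns the average of the energy of
one replica times `f` into `β * c` times a combination of overlap averages; with `f = 1` it gives
the mean energy. The covariance of energy and `f` is therefore `β * c` times the Ghirlanda–Guerra
defect of `f`. For `|f| ≤ 1` this covariance is at most the mean absolute deviation of the energy
(`ghirlanda_guerra_le`), so it suffices that the deviation be `o(c)` in `β`-average.

The deviation has two sources. The thermal variance is the `β`-derivative of the internal energy, so
its `β`-integral is an increment of the mean energy, of order `c`. The disorder fluctuations of the
internal energy are those of the derivative of the convex function `log Z`: difference quotients at
distance `δ` bound them by the fluctuations of `log Z`, at most `|β| * √c` by Efron–Stein, divided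
by `δ`, plus an increment of the monotone mean energy, whose `β`-integral is of order `δ * c`.
Division by `β * c` is harmless away from `β = 0`, and near `0` the bounded defect is integrated
over a short interval (`intervalIntegral_abs_le`).

The choices `f = R₁₂` with two and with three replicas give two linear relations among the averages,
from which both claims follow. -/

namespace GaussianGibbs

/-! ### Gaussian integration by parts and the Efron–Stein inequality -/

section GaussianProduct

lemma hasDerivAt_gaussianPDFReal_std (t : ℝ) :
    HasDerivAt (gaussianPDFReal 0 1) (-(t * gaussianPDFReal 0 1 t)) t := by
  have h : HasDerivAt (fun x : ℝ => -(x - 0) ^ 2 / (2 * ((1 : NNReal) : ℝ))) (-t) t := by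
    simp only [sub_zero, NNReal.coe_one, mul_one]
    exact (hasDerivAt_pow 2 t).neg.div_const 2 |>.congr_deriv (by push_cast; ring)
  have h2 := (h.exp).const_mul ((√(2 * Real.pi * ((1 : NNReal) : ℝ)))⁻¹)
  rw [gaussianPDFReal_def]
  exact h2.congr_deriv (by ring)

lemma integrable_mul_gaussianPDFReal_std :
    Integrable fun t : ℝ => t * gaussianPDFReal 0 1 t := by
  have h := (integrable_mul_exp_neg_mul_sq (b := 1 / 2) (by norm_num)).const_mul
    ((√(2 * Real.pi * ((1 : NNReal) : ℝ)))⁻¹)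
  refine h.congr (ae_of_all _ fun t => ?_)
  simp only [gaussianPDFReal_def, sub_zero, NNReal.coe_one]
  rw [show -t ^ 2 / (2 * 1) = -(1 / 2) * t ^ 2 by ring]
  ring

/-- Gaussian integration by parts on the line. -/
theorem integral_id_mul_gaussianReal_std {f f' : ℝ → ℝ} {C : ℝ}
    (hf : ∀ t, HasDerivAt f (f' t) t) (hf' : Continuous f')
    (hC : ∀ t, |f t| ≤ C) (hC' : ∀ t, |f' t| ≤ C) :
    ∫ t, t * f t ∂(gaussianReal 0 1) = ∫ t, f' t ∂(gaussianReal 0 1) := by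
  have hfc : Continuous f := continuous_iff_continuousAt.2 fun t => (hf t).continuousAt
  have h := integral_mul_deriv_eq_deriv_mul_of_integrable (u := f) (u' := f')
    (v := gaussianPDFReal 0 1) (v' := fun t => -(t * gaussianPDFReal 0 1 t))
    (fun x _ => hf x) (fun x _ => hasDerivAt_gaussianPDFReal_std x)
    (integrable_mul_gaussianPDFReal_std.neg.bdd_mul hfc.aestronglyMeasurable (ae_of_all _ hC))
    ((integrable_gaussianPDFReal 0 1).bdd_mul hf'.aestronglyMeasurable (ae_of_all _ hC'))
    ((integrable_gaussianPDFReal 0 1).bdd_mul hfc.aestronglyMeasurable (ae_of_all _ hC))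
  rw [integral_gaussianReal_eq_integral_smul one_ne_zero,
    integral_gaussianReal_eq_integral_smul one_ne_zero]
  have e1 : ∫ t, gaussianPDFReal 0 1 t • (t * f t)
      = -∫ t, f t * -(t * gaussianPDFReal 0 1 t) := by
    rw [← integral_neg]
    congr 1
    ext t
    simp only [smul_eq_mul]
    ring
  rw [e1, h, neg_neg]
  congr 1
  ext t
  simp only [smul_eq_mul]
  ring

variable {ι : Type*} [Fintype ι]

/-- Resampling one coordinate preserves a product of probability measures. -/
theorem measurePreserving_update [DecidableEq ι] {X : Type*} [MeasurableSpace X] (μ : Measure X)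
    [IsProbabilityMeasure μ] (i : ι) :
    MeasurePreserving (fun p : (ι → X) × X => Function.update p.1 i p.2)
      ((Measure.pi fun _ => μ).prod μ) (Measure.pi fun _ => μ) := by
  have hm : Measurable (fun p : (ι → X) × X => Function.update p.1 i p.2) := by
    refine measurable_pi_iff.2 fun j => ?_
    by_cases h : j = i
    · subst h; simpa using measurable_snd
    · simp only [Function.update_of_ne h]
      exact (measurable_pi_apply j).comp measurable_fst
  refine ⟨hm, (Measure.pi_eq fun s hs => ?_).symm⟩
  rw [Measure.map_apply hm (MeasurableSet.univ_pi hs)]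
  have : (fun p : (ι → X) × X => Function.update p.1 i p.2) ⁻¹' (Set.univ.pi s)
      = (Set.univ.pi (Function.update s i Set.univ)) ×ˢ s i := by
    ext p
    simp only [Set.mem_preimage, Set.mem_pi, Set.mem_univ, true_imp_iff, Set.mem_prod]
    constructor
    · intro h
      refine ⟨fun j => ?_, by simpa using h i⟩
      by_cases hj : j = i
      · subst hj; simp
      · simpa [Function.update_of_ne hj] using h j
    · rintro ⟨h, h'⟩ j
      by_cases hj : j = i
      · subst hj; simpa using h'
      · simpa [Function.update_of_ne hj] using h j
  rw [this, Measure.prod_prod, Measure.pi_pi, ← Finset.mul_prod_erase _ _ (Finset.mem_univ i),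
    ← Finset.mul_prod_erase _ (fun j => μ (s j)) (Finset.mem_univ i)]
  simp only [Function.update_self, measure_univ, one_mul]
  rw [mul_comm]
  congr 1
  refine Finset.prod_congr rfl fun j hj => ?_
  rw [Function.update_of_ne (Finset.ne_of_mem_erase hj)]

variable (ι) in
/-- The law of a family of independent standard Gaussians. -/
noncomputable abbrev stdGaussianPi : Measure (ι → ℝ) := Measure.pi fun _ => gaussianReal 0 1

lemma memLp_eval_stdGaussianPi (i : ι) : MemLp (fun ξ : ι → ℝ => ξ i) 2 (stdGaussianPi ι) := by
  have := (memLp_id_gaussianReal (μ := 0) (v := 1) 2).comp_measurePreserving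
    (measurePreserving_eval (fun _ : ι => gaussianReal 0 1) i)
  simpa [Function.comp_def] using this

/-- Gaussian integration by parts for one coordinate of a standard Gaussian family. -/
theorem integral_eval_mul_stdGaussianPi [DecidableEq ι] (i : ι) {F F' : (ι → ℝ) → ℝ} {C : ℝ}
    (hF : Continuous F) (hF' : Continuous F')
    (hd : ∀ ξ, HasDerivAt (fun t => F (Function.update ξ i t)) (F' ξ) (ξ i))
    (hC : ∀ ξ, |F ξ| ≤ C) (hC' : ∀ ξ, |F' ξ| ≤ C) :
    ∫ ξ, ξ i * F ξ ∂(stdGaussianPi ι) = ∫ ξ, F' ξ ∂(stdGaussianPi ι) := by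
  have hmp := measurePreserving_update (ι := ι) (gaussianReal 0 1) i
  have int1 : Integrable (fun ξ : ι → ℝ => ξ i * F ξ) (stdGaussianPi ι) :=
    ((memLp_eval_stdGaussianPi i).integrable one_le_two).mul_bdd hF.aestronglyMeasurable
      (ae_of_all _ hC)
  have int2 : Integrable F' (stdGaussianPi ι) :=
    Integrable.of_bound hF'.aestronglyMeasurable C (ae_of_all _ hC')
  -- Replacing `ξ i` by an independent copy `t` leaves the law unchanged, so the one-dimensional
  -- formula can be applied in `t` with the other coordinates frozen.
  have e : ∀ G : (ι → ℝ) → ℝ, Continuous G → Integrable G (stdGaussianPi ι) →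
      ∫ ξ, G ξ ∂(stdGaussianPi ι) = ∫ ξ, ∫ t, G (Function.update ξ i t) ∂(gaussianReal 0 1)
        ∂(stdGaussianPi ι) := by
    intro G hG hi
    have h1 : ∫ ξ, G ξ ∂(stdGaussianPi ι) = ∫ p : (ι → ℝ) × ℝ, G (Function.update p.1 i p.2)
        ∂((stdGaussianPi ι).prod (gaussianReal 0 1)) := by
      exact (congrArg (fun ν => ∫ ξ, G ξ ∂ν) hmp.map_eq.symm).trans
        (integral_map hmp.measurable.aemeasurable hG.aestronglyMeasurable)
    rw [h1, integral_prod]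
    exact hmp.integrable_comp_of_integrable hi
  rw [e (fun ξ => ξ i * F ξ) ((continuous_apply i).mul hF) int1, e _ hF' int2]
  refine integral_congr_ae (ae_of_all _ fun ξ => ?_)
  simp only [Function.update_self]
  refine integral_id_mul_gaussianReal_std (C := C) (fun t => ?_) ?_ (fun t => hC _) (fun t => hC' _)
  · simpa using hd (Function.update ξ i t)
  · exact hF'.comp (continuous_const.update i continuous_id)

lemma memLp_of_abs_sub_le {f : (ι → ℝ) → ℝ} {L : ι → ℝ} (hfc : Continuous f)
    (hf : ∀ x y, |f x - f y| ≤ ∑ i, L i * |x i - y i|) : MemLp f 2 (stdGaussianPi ι) := by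
  have h1 : MemLp (fun ξ : ι → ℝ => ∑ i, L i * |ξ i|) 2 (stdGaussianPi ι) :=
    memLp_finsetSum _ fun i _ => (memLp_eval_stdGaussianPi i).norm.const_mul (L i)
  have h : MemLp (fun ξ : ι → ℝ => |f 0| + ∑ i, L i * |ξ i|) 2 (stdGaussianPi ι) :=
    (memLp_const (|f 0|)).add h1
  refine h.mono hfc.aestronglyMeasurable (ae_of_all _ fun ξ => ?_)
  have h1 := hf ξ 0
  simp only [Pi.zero_apply, sub_zero] at h1
  rw [Real.norm_eq_abs, Real.norm_eq_abs]
  refine le_trans ?_ (le_abs_self _)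
  have := abs_sub_abs_le_abs_sub (f ξ) (f 0)
  linarith

lemma continuous_of_abs_sub_le {f : (ι → ℝ) → ℝ} {L : ι → ℝ}
    (hf : ∀ x y, |f x - f y| ≤ ∑ i, L i * |x i - y i|) : Continuous f := by
  refine continuous_iff_continuousAt.2 fun x => ?_
  refine tendsto_iff_dist_tendsto_zero.2 ?_
  refine squeeze_zero (fun _ => dist_nonneg) (fun y => hf y x) ?_
  have : Continuous fun y : ι → ℝ => ∑ i, L i * |y i - x i| := by fun_prop
  exact by
    have h := this.tendsto x
    simp only [sub_self, abs_zero, mul_zero, Finset.sum_const_zero] at h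
    exact h

lemma continuous_of_abs_sub_le_mul {h : ℝ → ℝ} {L : ℝ} (hL : ∀ s t, |h s - h t| ≤ L * |s - t|) :
    Continuous h := by
  have hL0 : 0 ≤ L := by simpa using (abs_nonneg _).trans (hL 1 0)
  refine (LipschitzWith.of_dist_le_mul (K := L.toNNReal) fun s t => ?_).continuous
  rw [Real.coe_toNNReal _ hL0]
  exact hL s t

lemma memLp_of_abs_sub_le_mul {h : ℝ → ℝ} {L : ℝ} (hL : ∀ s t, |h s - h t| ≤ L * |s - t|) :
    MemLp h 2 (gaussianReal 0 1) := by
  have h1 : MemLp (fun t : ℝ => L * |t|) 2 (gaussianReal 0 1) :=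
    (memLp_id_gaussianReal (μ := 0) (v := 1) 2).norm.const_mul L
  have hb : MemLp (fun t : ℝ => |h 0| + L * |t|) 2 (gaussianReal 0 1) :=
    (memLp_const (|h 0|)).add h1
  refine hb.mono (continuous_of_abs_sub_le_mul hL).aestronglyMeasurable (ae_of_all _ fun t => ?_)
  rw [Real.norm_eq_abs, Real.norm_eq_abs]
  refine le_trans ?_ (le_abs_self _)
  have h1 := hL t 0
  have h2 := abs_sub_abs_le_abs_sub (h t) (h 0)
  rw [sub_zero] at h1
  linarith

/-- The variance is at most the second moment about any point; about `h 0` the Lipschitz bound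
compares it with `L ^ 2` times the variance `1` of the Gaussian. -/
lemma variance_le_sq_of_abs_sub_le {h : ℝ → ℝ} {L : ℝ} (hL : ∀ s t, |h s - h t| ≤ L * |s - t|) :
    Var[h; gaussianReal 0 1] ≤ L ^ 2 := by
  have hc := continuous_of_abs_sub_le_mul hL
  rw [← variance_sub_const hc.aestronglyMeasurable (h 0)]
  have hid : Integrable (fun t : ℝ => t ^ 2) (gaussianReal 0 1) :=
    (memLp_id_gaussianReal (μ := 0) (v := 1) 2).integrable_sq
  have hv : ∫ t, t ^ 2 ∂(gaussianReal 0 1) = 1 := by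
    have h1 := variance_fun_id_gaussianReal (μ := 0) (v := 1)
    rw [variance_of_integral_eq_zero aemeasurable_id' integral_id_gaussianReal] at h1
    simpa using h1
  calc Var[fun t => h t - h 0; gaussianReal 0 1]
      ≤ ∫ t, (h t - h 0) ^ 2 ∂(gaussianReal 0 1) :=
        variance_le_expectation_sq (hc.sub continuous_const).aestronglyMeasurable
    _ ≤ ∫ t, L ^ 2 * t ^ 2 ∂(gaussianReal 0 1) := by
        refine integral_mono_of_nonneg (ae_of_all _ fun t => sq_nonneg _) (hid.const_mul _)
          (ae_of_all _ fun t => ?_)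
        have := hL t 0
        rw [sub_zero] at this
        change (h t - h 0) ^ 2 ≤ L ^ 2 * t ^ 2
        rw [← sq_abs (h t - h 0), ← sq_abs t, ← mul_pow]
        exact pow_le_pow_left₀ (abs_nonneg _) this 2
    _ = L ^ 2 := by rw [integral_const_mul, hv, mul_one]

lemma measurePreserving_finCons (n : ℕ) :
    MeasurePreserving (fun p : ℝ × (Fin n → ℝ) => (Fin.cons p.1 p.2 : Fin (n + 1) → ℝ))
      ((gaussianReal 0 1).prod (stdGaussianPi (Fin n))) (stdGaussianPi (Fin (n + 1))) := by
  convert (measurePreserving_piFinSuccAbove (fun _ : Fin (n + 1) => gaussianReal 0 1) 0).symm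
    using 1
  ext p
  simp [MeasurableEquiv.piFinSuccAbove_symm_apply, Fin.insertNthEquiv]

/-- Induction by splitting off one coordinate: its conditional variance costs at most `L 0 ^ 2`, and
the conditional mean `m` inherits the remaining Lipschitz constants. -/
lemma variance_stdGaussianPi_fin_le (n : ℕ) (L : Fin n → ℝ) (f : (Fin n → ℝ) → ℝ)
    (hf : ∀ x y, |f x - f y| ≤ ∑ i, L i * |x i - y i|) :
    Var[f; stdGaussianPi (Fin n)] ≤ ∑ i, L i ^ 2 := by
  induction n with
  | zero =>
    have h : f = fun _ => f 0 := funext fun x => congrArg f (Subsingleton.elim _ _)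
    rw [h, variance_eq_integral aemeasurable_const]
    simp
  | succ n ih =>
    set γ := gaussianReal 0 1
    set π := stdGaussianPi (Fin n)
    have hc := continuous_of_abs_sub_le hf
    have hmp := measurePreserving_finCons n
    let h : ℝ × (Fin n → ℝ) → ℝ := fun p => f (Fin.cons p.1 p.2)
    have hmem : MemLp h 2 (γ.prod π) := (memLp_of_abs_sub_le hc hf).comp_measurePreserving hmp
    have hlip1 : ∀ y s t, |h (s, y) - h (t, y)| ≤ L 0 * |s - t| := fun y s t => by
      simpa [Fin.sum_univ_succ] using hf (Fin.cons s y) (Fin.cons t y)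
    have hlip2 : ∀ t x y, |h (t, x) - h (t, y)| ≤ ∑ i, L i.succ * |x i - y i| := fun t x y => by
      simpa [Fin.sum_univ_succ] using hf (Fin.cons t x) (Fin.cons t y)
    have hsec : ∀ y, MemLp (fun t => h (t, y)) 2 γ := fun y => memLp_of_abs_sub_le_mul (hlip1 y)
    let m : (Fin n → ℝ) → ℝ := fun y => ∫ t, h (t, y) ∂γ
    have hm : ∀ x y, |m x - m y| ≤ ∑ i, L i.succ * |x i - y i| := fun x y => by
      have e : m x - m y = ∫ t, (h (t, x) - h (t, y)) ∂γ :=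
        (integral_sub ((hsec x).integrable one_le_two) ((hsec y).integrable one_le_two)).symm
      rw [e, ← Real.norm_eq_abs]
      refine (norm_integral_le_of_norm_le_const (C := ∑ i, L i.succ * |x i - y i|)
        (ae_of_all _ fun t => hlip2 t x y)).trans ?_
      simp
    have hmL := memLp_of_abs_sub_le (continuous_of_abs_sub_le hm) hm
    have hvar : ∀ y, (∫ t, h (t, y) ^ 2 ∂γ) ≤ L 0 ^ 2 + m y ^ 2 := fun y => by
      have h1 := variance_le_sq_of_abs_sub_le (hlip1 y)
      rw [variance_eq_sub (hsec y)] at h1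
      simp only [Pi.pow_apply] at h1
      change _ - m y ^ 2 ≤ _ at h1
      linarith
    have hv : Var[f; stdGaussianPi (Fin (n + 1))] = Var[h; γ.prod π] :=
      (hmp.variance_fun_comp hc.aemeasurable).symm
    have h2 : ∫ p, h p ^ 2 ∂(γ.prod π) ≤ L 0 ^ 2 + ∫ y, m y ^ 2 ∂π := by
      rw [integral_prod_symm _ hmem.integrable_sq]
      calc ∫ y, ∫ t, h (t, y) ^ 2 ∂γ ∂π ≤ ∫ y, (L 0 ^ 2 + m y ^ 2) ∂π :=
            integral_mono hmem.integrable_sq.integral_prod_right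
              ((integrable_const _).add hmL.integrable_sq) hvar
        _ = L 0 ^ 2 + ∫ y, m y ^ 2 ∂π := by
            rw [integral_add (integrable_const _) hmL.integrable_sq]
            simp [π]
    have h3 : ∫ p, h p ∂(γ.prod π) = ∫ y, m y ∂π :=
      integral_prod_symm _ (hmem.integrable one_le_two)
    have h4 := ih (fun i => L i.succ) m hm
    rw [variance_eq_sub hmL] at h4
    rw [hv, variance_eq_sub hmem, Fin.sum_univ_succ]
    simp only [Pi.pow_apply] at h4 ⊢
    rw [h3]
    linarith

/-- The Efron–Stein bound for functions that are Lipschitz in each coordinate. -/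
theorem variance_stdGaussianPi_le {L : ι → ℝ} {f : (ι → ℝ) → ℝ}
    (hf : ∀ x y, |f x - f y| ≤ ∑ i, L i * |x i - y i|) :
    Var[f; stdGaussianPi ι] ≤ ∑ i, L i ^ 2 := by
  let e := (Fintype.equivFin ι).symm
  have hmp := measurePreserving_piCongrLeft (fun _ : ι => gaussianReal 0 1) e
  have hc := continuous_of_abs_sub_le hf
  rw [← hmp.variance_fun_comp hc.aemeasurable, ← e.sum_comp]
  refine variance_stdGaussianPi_fin_le _ _ _ fun x y => (hf _ _).trans_eq ?_
  rw [← e.sum_comp]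
  simp [MeasurableEquiv.coe_piCongrLeft, Equiv.piCongrLeft_apply_apply]

end GaussianProduct

/-! ### Gibbs weights, replicas and integration by parts -/

section GibbsStates

variable {ι K : Type*} [Fintype ι]

/-- The Gaussian energy `∑ i, ξ i * v x i` of the configuration `x`. -/
def energy (v : K → ι → ℝ) (ξ : ι → ℝ) (x : K) : ℝ := ∑ i, ξ i * v x i

@[fun_prop]
lemma continuous_energy (v : K → ι → ℝ) (x : K) : Continuous fun ξ => energy v ξ x := by
  unfold energy; fun_prop

lemma energy_update [DecidableEq ι] (v : K → ι → ℝ) (ξ : ι → ℝ) (i : ι) (t : ℝ) (x : K) :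
    energy v (Function.update ξ i t) x = energy v ξ x + (t - ξ i) * v x i := by
  unfold energy
  rw [← Finset.add_sum_erase _ _ (Finset.mem_univ i),
    ← Finset.add_sum_erase _ (fun j => ξ j * v x j) (Finset.mem_univ i),
    Finset.sum_congr rfl fun j hj => by rw [Function.update_of_ne (Finset.ne_of_mem_erase hj)]]
  simp only [Function.update_self]
  ring

lemma memLp_energy (v : K → ι → ℝ) (x : K) :
    MemLp (fun ξ => energy v ξ x) 2 (stdGaussianPi ι) := by
  unfold energy
  exact memLp_finsetSum _ fun i _ => (memLp_eval_stdGaussianPi i).mul_const (v x i)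

variable [Fintype K]

/-- The partition function of the Gaussian energy. -/
noncomputable def partition (v : K → ι → ℝ) (β : ℝ) (ξ : ι → ℝ) : ℝ :=
  ∑ x, Real.exp (β * energy v ξ x)

/-- The Gibbs weight of a configuration. -/
noncomputable def weight (v : K → ι → ℝ) (β : ℝ) (ξ : ι → ℝ) (x : K) : ℝ :=
  Real.exp (β * energy v ξ x) / partition v β ξ

/-- The Gibbs average of `f`. -/
noncomputable def gibbs (v : K → ι → ℝ) (β : ℝ) (ξ : ι → ℝ) (f : K → ℝ) : ℝ :=
  ∑ x, weight v β ξ x * f x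

/-- The average of `F` over `s` independent replicas. -/
noncomputable def replicas {s : ℕ} (v : K → ι → ℝ) (β : ℝ) (ξ : ι → ℝ)
    (F : (Fin s → K) → ℝ) : ℝ :=
  ∑ X : Fin s → K, (∏ a, weight v β ξ (X a)) * F X

/-- The replica average of `F`, averaged over the Gaussian couplings. -/
noncomputable def quenched {s : ℕ} (v : K → ι → ℝ) (β : ℝ) (F : (Fin s → K) → ℝ) : ℝ :=
  ∫ ξ, replicas v β ξ F ∂(stdGaussianPi ι)

variable {v : K → ι → ℝ} {β : ℝ} {ξ : ι → ℝ} {s : ℕ}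

lemma abs_energy_le (v : K → ι → ℝ) (ξ : ι → ℝ) (x : K) :
    |energy v ξ x| ≤ ∑ y, |energy v ξ y| :=
  Finset.single_le_sum (f := fun y => |energy v ξ y|) (fun _ _ => abs_nonneg _)
    (Finset.mem_univ x)

lemma memLp_sum_abs_energy (v : K → ι → ℝ) :
    MemLp (fun ξ => ∑ x, |energy v ξ x|) 2 (stdGaussianPi ι) :=
  memLp_finsetSum _ fun x _ => (memLp_energy v x).norm

lemma weight_nonneg (x : K) : 0 ≤ weight v β ξ x :=
  div_nonneg (Real.exp_pos _).le (Finset.sum_nonneg fun _ _ => (Real.exp_pos _).le)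

lemma prod_weight_nonneg (X : Fin s → K) : 0 ≤ ∏ a, weight v β ξ (X a) :=
  Finset.prod_nonneg fun _ _ => weight_nonneg _

/-- Replicas are independent given the couplings, so the last one can be averaged first. Read
backwards, a Gibbs average inside a replica average becomes one more replica. -/
lemma replicas_succ (G : (Fin (s + 1) → K) → ℝ) :
    replicas v β ξ G = replicas v β ξ fun X : Fin s → K =>
      gibbs v β ξ fun y => G (Fin.snoc X y) := by
  unfold replicas gibbs
  rw [← (Fin.snocEquiv fun _ => K).sum_comp, Fintype.sum_prod_type_right]
  refine Finset.sum_congr rfl fun X _ => ?_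
  rw [Finset.mul_sum]
  refine Finset.sum_congr rfl fun y _ => ?_
  rw [Fin.prod_univ_castSucc]
  simp [Fin.snocEquiv]
  ring

lemma replicas_comp_perm (e : Equiv.Perm (Fin s)) (F : (Fin s → K) → ℝ) :
    replicas v β ξ (fun X => F (X ∘ e)) = replicas v β ξ F := by
  unfold replicas
  rw [← (e.arrowCongr (Equiv.refl K)).sum_comp]
  refine Finset.sum_congr rfl fun X _ => ?_
  rw [← Equiv.prod_comp e]
  simp [Equiv.arrowCongr, Function.comp_def]

lemma quenched_comp_perm (e : Equiv.Perm (Fin s)) (F : (Fin s → K) → ℝ) :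
    quenched v β (fun X => F (X ∘ e)) = quenched v β F := by
  unfold quenched; simp only [replicas_comp_perm]

section Nonempty

variable [Nonempty K]

lemma partition_pos : 0 < partition v β ξ :=
  Finset.sum_pos (fun _ _ => Real.exp_pos _) Finset.univ_nonempty

lemma sum_weight : ∑ x, weight v β ξ x = 1 := by
  unfold weight
  rw [← Finset.sum_div]
  exact div_self partition_pos.ne'

lemma weight_le_one (x : K) : weight v β ξ x ≤ 1 := by
  rw [← sum_weight (v := v) (β := β) (ξ := ξ)]
  exact Finset.single_le_sum (f := weight v β ξ) (fun _ _ => weight_nonneg _) (Finset.mem_univ x)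

lemma continuous_weight (v : K → ι → ℝ) (x : K) :
    Continuous fun p : ℝ × (ι → ℝ) => weight v p.1 p.2 x := by
  unfold weight
  refine Continuous.div ?_ ?_ fun _ => partition_pos.ne'
  · fun_prop
  · unfold partition; fun_prop

@[fun_prop]
lemma continuous_weight_right (v : K → ι → ℝ) (β : ℝ) (x : K) :
    Continuous fun ξ => weight v β ξ x :=
  (continuous_weight v x).comp (Continuous.prodMk_right β)

/-- The logarithmic derivative of a normalized exponential is the derivative of its exponent minus
the Gibbs mean of these derivatives. It serves both for `β` and for a single coupling. -/
lemma hasDerivAt_exp_div_sum {h : K → ℝ → ℝ} {h' : K → ℝ} {t : ℝ}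
    (hh : ∀ x, HasDerivAt (h x) (h' x) t) (x : K) :
    HasDerivAt (fun u => Real.exp (h x u) / ∑ y, Real.exp (h y u))
      (Real.exp (h x t) / (∑ y, Real.exp (h y t)) *
        (h' x - ∑ z, Real.exp (h z t) / (∑ y, Real.exp (h y t)) * h' z)) t := by
  have hpos : 0 < ∑ y, Real.exp (h y t) :=
    Finset.sum_pos (fun _ _ => Real.exp_pos _) Finset.univ_nonempty
  have hs : HasDerivAt (fun u => ∑ y, Real.exp (h y u)) (∑ y, Real.exp (h y t) * h' y) t :=
    HasDerivAt.fun_sum fun y _ => (hh y).exp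
  refine ((hh x).exp.div hs hpos.ne').congr_deriv ?_
  simp_rw [div_mul_eq_mul_div]
  rw [← Finset.sum_div]
  field_simp

lemma hasDerivAt_weight_beta (v : K → ι → ℝ) (β : ℝ) (ξ : ι → ℝ) (x : K) :
    HasDerivAt (fun b => weight v b ξ x)
      (weight v β ξ x * (energy v ξ x - gibbs v β ξ (energy v ξ))) β :=
  hasDerivAt_exp_div_sum (h := fun y b => b * energy v ξ y) (h' := energy v ξ)
    (fun y => by simpa using (hasDerivAt_id β).mul_const (energy v ξ y)) x

lemma hasDerivAt_weight_update [DecidableEq ι] (v : K → ι → ℝ) (β : ℝ) (ξ : ι → ℝ) (i : ι)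
    (x : K) :
    HasDerivAt (fun t => weight v β (Function.update ξ i t) x)
      (β * (weight v β ξ x * (v x i - gibbs v β ξ fun y => v y i))) (ξ i) := by
  have h := hasDerivAt_exp_div_sum (t := ξ i)
    (h := fun y t => β * energy v (Function.update ξ i t) y) (h' := fun y => β * v y i)
    (fun y => by
      simp_rw [energy_update]
      have := ((((hasDerivAt_id (ξ i)).sub_const (ξ i)).mul_const (v y i)).const_add
        (energy v ξ y)).const_mul β
      simpa using this) x
  simp only [Function.update_eq_self] at h
  refine h.congr_deriv ?_
  unfold gibbs weight partition
  have e : ∀ z, Real.exp (β * energy v ξ z) / (∑ y, Real.exp (β * energy v ξ y)) * (β * v z i)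
      = β * (Real.exp (β * energy v ξ z) / (∑ y, Real.exp (β * energy v ξ y)) * v z i) :=
    fun z => by ring
  simp only [e]
  rw [← Finset.mul_sum]
  ring

lemma hasDerivAt_prod_weight_update [DecidableEq ι] (v : K → ι → ℝ) (β : ℝ) (ξ : ι → ℝ) (i : ι)
    (X : Fin s → K) :
    HasDerivAt (fun t => ∏ a, weight v β (Function.update ξ i t) (X a))
      (β * ((∏ a, weight v β ξ (X a)) * ∑ a, (v (X a) i - gibbs v β ξ fun y => v y i))) (ξ i) := by
  have h := HasDerivAt.fun_finsetProd (u := (Finset.univ : Finset (Fin s))) (x := ξ i)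
    (fun a _ => hasDerivAt_weight_update v β ξ i (X a))
  refine h.congr_deriv ?_
  rw [Finset.mul_sum, Finset.mul_sum]
  refine Finset.sum_congr rfl fun a _ => ?_
  rw [Function.update_eq_self, smul_eq_mul, ← Finset.mul_prod_erase _ _ (Finset.mem_univ a)]
  ring

lemma abs_gibbs_le {f : K → ℝ} {C : ℝ} (hf : ∀ x, |f x| ≤ C) : |gibbs v β ξ f| ≤ C := by
  calc |gibbs v β ξ f| ≤ ∑ x, |weight v β ξ x * f x| := Finset.abs_sum_le_sum_abs _ _
    _ ≤ ∑ x, weight v β ξ x * C := Finset.sum_le_sum fun x _ => by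
        rw [abs_mul, abs_of_nonneg (weight_nonneg x)]
        exact mul_le_mul_of_nonneg_left (hf x) (weight_nonneg x)
    _ = C := by rw [← Finset.sum_mul, sum_weight, one_mul]

lemma prod_weight_le_one (X : Fin s → K) : ∏ a, weight v β ξ (X a) ≤ 1 :=
  Finset.prod_le_one (fun _ _ => weight_nonneg _) fun _ _ => weight_le_one _

lemma sum_prod_weight (v : K → ι → ℝ) (β : ℝ) (ξ : ι → ℝ) (s : ℕ) :
    ∑ X : Fin s → K, ∏ a, weight v β ξ (X a) = 1 := by
  classical
  rw [← Fintype.piFinset_univ, ← Finset.prod_univ_sum]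
  simp [sum_weight]

lemma gibbs_const (a : ℝ) : gibbs v β ξ (fun _ => a) = a := by
  unfold gibbs
  rw [← Finset.sum_mul, sum_weight, one_mul]

lemma replicas_init (F : (Fin s → K) → ℝ) :
    replicas v β ξ (fun Y : Fin (s + 1) → K => F (Fin.init Y)) = replicas v β ξ F := by
  rw [replicas_succ]
  simp only [Fin.init_snoc, gibbs_const]

lemma replicas_const (a : ℝ) : replicas v β ξ (fun _ : Fin s → K => a) = a := by
  unfold replicas
  rw [← Finset.sum_mul, sum_prod_weight, one_mul]

lemma abs_replicas_le {F : (Fin s → K) → ℝ} {C : ℝ} (hF : ∀ X, |F X| ≤ C) :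
    |replicas v β ξ F| ≤ C := by
  calc |replicas v β ξ F| ≤ ∑ X : Fin s → K, |(∏ a, weight v β ξ (X a)) * F X| :=
        Finset.abs_sum_le_sum_abs _ _
    _ ≤ ∑ X : Fin s → K, (∏ a, weight v β ξ (X a)) * C := Finset.sum_le_sum fun X _ => by
        rw [abs_mul, abs_of_nonneg (prod_weight_nonneg X)]
        exact mul_le_mul_of_nonneg_left (hF X) (prod_weight_nonneg X)
    _ = C := by rw [← Finset.sum_mul, sum_prod_weight, one_mul]

@[fun_prop]
lemma continuous_replicas (v : K → ι → ℝ) (β : ℝ) (F : (Fin s → K) → ℝ) :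
    Continuous fun ξ => replicas v β ξ F := by
  unfold replicas; fun_prop

lemma integrable_replicas (v : K → ι → ℝ) (β : ℝ) (F : (Fin s → K) → ℝ) :
    Integrable (fun ξ => replicas v β ξ F) (stdGaussianPi ι) :=
  Integrable.of_bound (by fun_prop : Continuous _).aestronglyMeasurable (∑ X, |F X|)
    (ae_of_all _ fun ξ => abs_replicas_le fun X =>
      Finset.single_le_sum (f := fun X => |F X|) (fun _ _ => abs_nonneg _) (Finset.mem_univ X))

lemma abs_quenched_le {F : (Fin s → K) → ℝ} {C : ℝ} (hF : ∀ X, |F X| ≤ C) :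
    |quenched v β F| ≤ C := by
  refine (norm_integral_le_of_norm_le_const (C := C)
    (ae_of_all _ fun ξ => (Real.norm_eq_abs _).trans_le (abs_replicas_le hF))).trans ?_
  simp

lemma quenched_init (F : (Fin s → K) → ℝ) :
    quenched v β (fun Y : Fin (s + 1) → K => F (Fin.init Y)) = quenched v β F := by
  unfold quenched; simp only [replicas_init]

lemma quenched_const (a : ℝ) : quenched v β (fun _ : Fin s → K => a) = a := by
  unfold quenched; simp [replicas_const]

/-- Gaussian integration by parts for replica averages. -/
theorem integral_replicas_energy_mul {c : ℝ} {R : K → K → ℝ}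
    (hR : ∀ x y, ∑ i, v x i * v y i = c * R x y) (β : ℝ) (b : Fin s) (f : (Fin s → K) → ℝ) :
    ∫ ξ, replicas v β ξ (fun X => energy v ξ (X b) * f X) ∂(stdGaussianPi ι) =
      β * c * (∑ a, quenched v β (fun X => R (X b) (X a) * f X)
        - s * quenched v β fun Y : Fin (s + 1) → K =>
            R (Y b.castSucc) (Y (Fin.last s)) * f (Fin.init Y)) := by
  classical
  -- The derivative of the product weight in the coupling `ξ i`.
  let D : ι → (Fin s → K) → (ι → ℝ) → ℝ := fun i X ξ =>
    β * ((∏ a, weight v β ξ (X a)) * ∑ a, (v (X a) i - gibbs v β ξ fun y => v y i))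
  have hDc : ∀ i X, Continuous (D i X) := fun i X => by
    simp only [D, gibbs]; fun_prop
  have hDb : ∀ i (X : Fin s → K), ∃ C, ∀ ξ, |∏ a, weight v β ξ (X a)| ≤ C ∧ |D i X ξ| ≤ C := fun i X => by
    set M := ∑ x, |v x i| with hM
    have hv : ∀ x, |v x i| ≤ M := fun x =>
      Finset.single_le_sum (f := fun x => |v x i|) (fun _ _ => abs_nonneg _) (Finset.mem_univ x)
    have hM0 : 0 ≤ M := Finset.sum_nonneg fun _ _ => abs_nonneg _
    refine ⟨max 1 (|β| * (1 * ∑ a : Fin s, (M + M))), fun ξ => ?_⟩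
    have h1 : |∏ a, weight v β ξ (X a)| ≤ 1 := by
      rw [abs_of_nonneg (prod_weight_nonneg X)]; exact prod_weight_le_one X
    refine ⟨h1.trans (le_max_left _ _), le_trans ?_ (le_max_right _ _)⟩
    simp only [D]
    rw [abs_mul, abs_mul]
    refine mul_le_mul_of_nonneg_left (mul_le_mul h1 ?_ (abs_nonneg _) zero_le_one) (abs_nonneg _)
    refine (Finset.abs_sum_le_sum_abs _ _).trans (Finset.sum_le_sum fun a _ => ?_)
    exact (abs_sub _ _).trans (add_le_add (hv _) (abs_gibbs_le hv))
  have hparts : ∀ i (X : Fin s → K), ∫ ξ, ξ i * ∏ a, weight v β ξ (X a) ∂(stdGaussianPi ι)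
      = ∫ ξ, D i X ξ ∂(stdGaussianPi ι) := fun i X => by
    obtain ⟨C, hC⟩ := hDb i X
    exact integral_eval_mul_stdGaussianPi i (by fun_prop) (hDc i X)
      (fun ξ => hasDerivAt_prod_weight_update v β ξ i X) (fun ξ => (hC ξ).1) (fun ξ => (hC ξ).2)
  have hi1 : ∀ i (X : Fin s → K), Integrable (fun ξ : ι → ℝ => ξ i * ∏ a, weight v β ξ (X a))
      (stdGaussianPi ι) := fun i X => by
    obtain ⟨C, hC⟩ := hDb i X
    exact ((memLp_eval_stdGaussianPi i).integrable one_le_two).mul_bdd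
      (by fun_prop : Continuous _).aestronglyMeasurable (ae_of_all _ fun ξ => (hC ξ).1)
  have hi2 : ∀ i X, Integrable (D i X) (stdGaussianPi ι) := fun i X => by
    obtain ⟨C, hC⟩ := hDb i X
    exact Integrable.of_bound (hDc i X).aestronglyMeasurable C (ae_of_all _ fun ξ => (hC ξ).2)
  have hL : ∀ ξ, replicas v β ξ (fun X => energy v ξ (X b) * f X)
      = ∑ X, ∑ i, (f X * v (X b) i) * (ξ i * ∏ a, weight v β ξ (X a)) := fun ξ => by
    unfold replicas energy
    refine Finset.sum_congr rfl fun X _ => ?_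
    simp only [Finset.sum_mul, Finset.mul_sum]
    exact Finset.sum_congr rfl fun i _ => by ring
  have hRhs : ∀ ξ, ∑ X, ∑ i, (f X * v (X b) i) * D i X ξ
      = β * c * (∑ a, replicas v β ξ (fun X => R (X b) (X a) * f X)
        - s * replicas v β ξ fun Y : Fin (s + 1) → K =>
            R (Y b.castSucc) (Y (Fin.last s)) * f (Fin.init Y)) := fun ξ => by
    -- Summation over the couplings contracts the coefficients into the covariance. Each of the `s`
    -- weights contributes the same Gibbs mean, hence the factor `s` in front of the new replica.
    have e1 : ∀ X : Fin s → K, ∑ i, v (X b) i * ∑ a, (v (X a) i - gibbs v β ξ fun y => v y i)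
        = c * (∑ a, R (X b) (X a) - s * gibbs v β ξ fun y => R (X b) y) := fun X => by
      have e2 : ∑ i, v (X b) i * gibbs v β ξ (fun y => v y i)
          = c * gibbs v β ξ fun y => R (X b) y := by
        unfold gibbs
        simp_rw [Finset.mul_sum]
        rw [Finset.sum_comm]
        refine Finset.sum_congr rfl fun y _ => ?_
        rw [mul_left_comm, ← hR, Finset.mul_sum]
        exact Finset.sum_congr rfl fun i _ => by ring
      simp only [Finset.sum_sub_distrib, Finset.sum_const, Finset.card_univ, Fintype.card_fin,
        nsmul_eq_mul, mul_sub]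
      rw [mul_left_comm c, ← e2, Finset.mul_sum, Finset.mul_sum]
      congr 1
      · simp_rw [Finset.mul_sum]
        rw [Finset.sum_comm]
        exact Finset.sum_congr rfl fun a _ => hR _ _
      · exact Finset.sum_congr rfl fun i _ => by ring
    rw [replicas_succ]
    have e3 : ∀ X : Fin s → K, (gibbs v β ξ fun y =>
        R ((Fin.snoc X y : Fin (s + 1) → K) b.castSucc)
          ((Fin.snoc X y : Fin (s + 1) → K) (Fin.last s)) * f (Fin.init (Fin.snoc X y : Fin (s + 1) → K)))
        = (gibbs v β ξ fun y => R (X b) y) * f X := fun X => by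
      simp only [Fin.snoc_castSucc, Fin.snoc_last, Fin.init_snoc]
      unfold gibbs
      rw [Finset.sum_mul]
      exact Finset.sum_congr rfl fun y _ => by ring
    simp only [e3]
    unfold replicas
    rw [Finset.sum_comm (s := (Finset.univ : Finset (Fin s))), Finset.mul_sum,
      ← Finset.sum_sub_distrib, Finset.mul_sum]
    refine Finset.sum_congr rfl fun X _ => ?_
    rw [← Finset.mul_sum, ← Finset.sum_mul]
    calc ∑ i, (f X * v (X b) i) * D i X ξ
        = β * (∏ a, weight v β ξ (X a)) * f X *
          ∑ i, v (X b) i * ∑ a, (v (X a) i - gibbs v β ξ fun y => v y i) := by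
          rw [Finset.mul_sum]
          exact Finset.sum_congr rfl fun i _ => by simp only [D]; ring
      _ = _ := by rw [e1]; ring
  calc ∫ ξ, replicas v β ξ (fun X => energy v ξ (X b) * f X) ∂(stdGaussianPi ι)
      = ∑ X, ∑ i, (f X * v (X b) i) * ∫ ξ, ξ i * ∏ a, weight v β ξ (X a) ∂(stdGaussianPi ι) := by
        simp only [hL]
        rw [integral_finsetSum _ fun X _ => integrable_finsetSum _ fun i _ =>
          (hi1 i X).const_mul _]
        refine Finset.sum_congr rfl fun X _ => ?_
        rw [integral_finsetSum _ fun i _ => (hi1 i X).const_mul _]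
        exact Finset.sum_congr rfl fun i _ => integral_const_mul _ _
    _ = ∫ ξ, ∑ X, ∑ i, (f X * v (X b) i) * D i X ξ ∂(stdGaussianPi ι) := by
        rw [integral_finsetSum _ fun X _ => integrable_finsetSum _ fun i _ =>
          (hi2 i X).const_mul _]
        refine Finset.sum_congr rfl fun X _ => ?_
        rw [integral_finsetSum _ fun i _ => (hi2 i X).const_mul _]
        exact Finset.sum_congr rfl fun i _ => by rw [hparts]; exact (integral_const_mul _ _).symm
    _ = _ := by
        simp only [hRhs]
        rw [integral_const_mul, integral_sub (integrable_finsetSum _ fun a _ =>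
          integrable_replicas _ _ _) ((integrable_replicas _ _ _).const_mul _),
          integral_finsetSum _ fun a _ => integrable_replicas _ _ _, integral_const_mul]
        rfl

end Nonempty

end GibbsStates

/-! ### Fluctuations of the energy and the Ghirlanda–Guerra bound -/

section Concentration

variable {ι K : Type*} [Fintype ι] [Fintype K]

/-- The Gibbs average of the energy. -/
noncomputable def internalEnergy (v : K → ι → ℝ) (β : ℝ) (ξ : ι → ℝ) : ℝ :=
  gibbs v β ξ (energy v ξ)

/-- The Gibbs variance of the energy. -/
noncomputable def energyVariance (v : K → ι → ℝ) (β : ℝ) (ξ : ι → ℝ) : ℝ :=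
  gibbs v β ξ fun x => (energy v ξ x - internalEnergy v β ξ) ^ 2

/-- The internal energy averaged over the couplings. -/
noncomputable def meanEnergy (v : K → ι → ℝ) (β : ℝ) : ℝ :=
  ∫ ξ, internalEnergy v β ξ ∂(stdGaussianPi ι)

/-- The mean absolute deviation of the energy under the averaged Gibbs measure. -/
noncomputable def energyDeviation (v : K → ι → ℝ) (β : ℝ) : ℝ :=
  ∫ ξ, gibbs v β ξ (fun x => |energy v ξ x - meanEnergy v β|) ∂(stdGaussianPi ι)

variable {v : K → ι → ℝ} {β c : ℝ} {ξ : ι → ℝ} {s : ℕ} {R : K → K → ℝ} {L : ι → ℝ}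

lemma gibbs_mono {f g : K → ℝ} (h : ∀ x, f x ≤ g x) : gibbs v β ξ f ≤ gibbs v β ξ g :=
  Finset.sum_le_sum fun x _ => mul_le_mul_of_nonneg_left (h x) (weight_nonneg x)

lemma gibbs_nonneg {f : K → ℝ} (h : ∀ x, 0 ≤ f x) : 0 ≤ gibbs v β ξ f :=
  Finset.sum_nonneg fun x _ => mul_nonneg (weight_nonneg x) (h x)

lemma gibbs_add (f g : K → ℝ) :
    gibbs v β ξ (fun x => f x + g x) = gibbs v β ξ f + gibbs v β ξ g := by
  simp only [gibbs, mul_add, Finset.sum_add_distrib]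

lemma gibbs_const_mul (a : ℝ) (f : K → ℝ) :
    gibbs v β ξ (fun x => a * f x) = a * gibbs v β ξ f := by
  simp only [gibbs, Finset.mul_sum, mul_left_comm]

lemma energyVariance_nonneg : 0 ≤ energyVariance v β ξ := gibbs_nonneg fun _ => sq_nonneg _

variable [Nonempty K]

lemma continuous_internalEnergy (v : K → ι → ℝ) :
    Continuous fun p : ℝ × (ι → ℝ) => internalEnergy v p.1 p.2 := by
  unfold internalEnergy gibbs
  exact continuous_finsetSum _ fun x _ =>
    (continuous_weight v x).mul ((continuous_energy v x).comp continuous_snd)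

lemma continuous_energyVariance (v : K → ι → ℝ) :
    Continuous fun p : ℝ × (ι → ℝ) => energyVariance v p.1 p.2 := by
  unfold energyVariance gibbs
  exact continuous_finsetSum _ fun x _ => (continuous_weight v x).mul
    ((((continuous_energy v x).comp continuous_snd).sub (continuous_internalEnergy v)).pow 2)

@[fun_prop]
lemma continuous_internalEnergy_right (v : K → ι → ℝ) (β : ℝ) :
    Continuous (internalEnergy v β) :=
  (continuous_internalEnergy v).comp (Continuous.prodMk_right β)

@[fun_prop]
lemma continuous_energyVariance_right (v : K → ι → ℝ) (β : ℝ) :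
    Continuous (energyVariance v β) :=
  (continuous_energyVariance v).comp (Continuous.prodMk_right β)

lemma abs_internalEnergy_le : |internalEnergy v β ξ| ≤ ∑ x, |energy v ξ x| :=
  abs_gibbs_le fun x => abs_energy_le v ξ x

lemma integrable_internalEnergy (v : K → ι → ℝ) (β : ℝ) :
    Integrable (internalEnergy v β) (stdGaussianPi ι) := by
  refine ((memLp_sum_abs_energy v).integrable one_le_two).mono'
    (by fun_prop : Continuous _).aestronglyMeasurable (ae_of_all _ fun ξ => ?_)
  exact abs_internalEnergy_le

lemma energyVariance_eq (v : K → ι → ℝ) (β : ℝ) (ξ : ι → ℝ) : energyVariance v β ξ =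
    gibbs v β ξ (fun x => energy v ξ x ^ 2) - internalEnergy v β ξ ^ 2 := by
  unfold energyVariance
  set u := internalEnergy v β ξ with hu
  have e : (fun x => (energy v ξ x - u) ^ 2)
      = fun x => energy v ξ x ^ 2 + ((-2 * u) * energy v ξ x + u ^ 2) := by
    ext x; ring
  rw [e, gibbs_add, gibbs_add, gibbs_const_mul, gibbs_const]
  change _ + (-2 * u * u + _) = _
  ring

lemma energyVariance_le : energyVariance v β ξ ≤ (∑ x, |energy v ξ x|) ^ 2 := by
  rw [energyVariance_eq]
  have h : gibbs v β ξ (fun x => energy v ξ x ^ 2) ≤ (∑ x, |energy v ξ x|) ^ 2 := by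
    refine (le_abs_self _).trans (abs_gibbs_le fun x => ?_)
    rw [abs_of_nonneg (sq_nonneg _), ← sq_abs]
    exact pow_le_pow_left₀ (abs_nonneg _) (abs_energy_le v ξ x) 2
  linarith [sq_nonneg (internalEnergy v β ξ)]

lemma hasDerivAt_internalEnergy (v : K → ι → ℝ) (β : ℝ) (ξ : ι → ℝ) :
    HasDerivAt (fun b => internalEnergy v b ξ) (energyVariance v β ξ) β := by
  have h : HasDerivAt (fun b => internalEnergy v b ξ)
      (∑ x, weight v β ξ x * (energy v ξ x - internalEnergy v β ξ) * energy v ξ x) β := by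
    unfold internalEnergy
    exact HasDerivAt.fun_sum fun x _ => (hasDerivAt_weight_beta v β ξ x).mul_const _
  refine h.congr_deriv ?_
  rw [energyVariance_eq]
  have e : internalEnergy v β ξ ^ 2
      = ∑ x, internalEnergy v β ξ * (weight v β ξ x * energy v ξ x) := by
    rw [← Finset.mul_sum, sq]; rfl
  rw [e, gibbs, ← Finset.sum_sub_distrib]
  exact Finset.sum_congr rfl fun x _ => by ring

lemma integrable_energyVariance (v : K → ι → ℝ) (β : ℝ) :
    Integrable (energyVariance v β) (stdGaussianPi ι) := by
  refine (memLp_sum_abs_energy v).integrable_sq.mono'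
    (by fun_prop : Continuous _).aestronglyMeasurable (ae_of_all _ fun ξ => ?_)
  rw [Real.norm_of_nonneg energyVariance_nonneg]
  exact energyVariance_le

lemma integrable_uncurry_energyVariance (v : K → ι → ℝ) (a b : ℝ) :
    Integrable (Function.uncurry (energyVariance v))
      ((volume.restrict (Set.uIoc a b)).prod (stdGaussianPi ι)) := by
  have : IsFiniteMeasure (volume.restrict (Set.uIoc a b)) := by
    rw [Set.uIoc]; infer_instance
  refine ((memLp_sum_abs_energy v).integrable_sq.comp_snd _).mono'
    (continuous_energyVariance v).aestronglyMeasurable (ae_of_all _ fun p => ?_)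
  change |energyVariance v p.1 p.2| ≤ _
  rw [abs_of_nonneg energyVariance_nonneg]
  exact energyVariance_le

/-- Fluctuation–dissipation: for fixed couplings the thermal variance is the `β`-derivative of the
internal energy; Fubini and the fundamental theorem of calculus do the rest. -/
lemma integral_energyVariance (v : K → ι → ℝ) (a b : ℝ) :
    ∫ β in a..b, ∫ ξ, energyVariance v β ξ ∂(stdGaussianPi ι)
      = meanEnergy v b - meanEnergy v a := by
  rw [intervalIntegral_integral_swap (integrable_uncurry_energyVariance v a b)]
  unfold meanEnergy
  rw [← integral_sub (integrable_internalEnergy v b) (integrable_internalEnergy v a)]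
  refine integral_congr_ae (ae_of_all _ fun ξ => ?_)
  refine intervalIntegral.integral_eq_sub_of_hasDerivAt
    (fun β _ => hasDerivAt_internalEnergy v β ξ) ?_
  exact ((continuous_energyVariance v).comp (Continuous.prodMk_left ξ)).intervalIntegrable _ _

/-- The log-partition function lies above its tangents. -/
lemma log_partition_add_le (v : K → ι → ℝ) (β β' : ℝ) (ξ : ι → ℝ) :
    Real.log (partition v β ξ) + (β' - β) * internalEnergy v β ξ
      ≤ Real.log (partition v β' ξ) := by
  have hZ := partition_pos (v := v) (β := β) (ξ := ξ)
  have hZ' := partition_pos (v := v) (β := β') (ξ := ξ)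
  set u := internalEnergy v β ξ with hu
  rw [← Real.log_exp ((β' - β) * u), ← Real.log_mul hZ.ne' (Real.exp_pos _).ne']
  refine Real.log_le_log (mul_pos hZ (Real.exp_pos _)) ?_
  -- Jensen's inequality for the exponential, through `t + 1 ≤ exp t`, whose linear part averages to
  -- `1`.
  have h1 : (1 : ℝ) ≤ gibbs v β ξ fun x => Real.exp ((β' - β) * (energy v ξ x - u)) := by
    have h2 : gibbs v β ξ (fun x => (β' - β) * energy v ξ x + (1 - (β' - β) * u)) = 1 := by
      rw [gibbs_add, gibbs_const_mul, gibbs_const]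
      change (β' - β) * u + _ = _
      ring
    rw [← h2]
    refine gibbs_mono fun x => ?_
    have := Real.add_one_le_exp ((β' - β) * (energy v ξ x - u))
    linarith
  calc partition v β ξ * Real.exp ((β' - β) * u)
      ≤ (partition v β ξ * Real.exp ((β' - β) * u)) *
        gibbs v β ξ fun x => Real.exp ((β' - β) * (energy v ξ x - u)) :=
        le_mul_of_one_le_right (mul_pos hZ (Real.exp_pos _)).le h1
    _ = partition v β' ξ := by
        unfold gibbs weight
        rw [Finset.mul_sum]
        conv_rhs => unfold partition
        refine Finset.sum_congr rfl fun x _ => ?_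
        rw [show β' * energy v ξ x = (β' - β) * u + β * energy v ξ x
          + (β' - β) * (energy v ξ x - u) by ring, Real.exp_add, Real.exp_add]
        field_simp

/-- A change of couplings multiplies each Boltzmann factor by at most `exp T`, hence also their sum.
-/
lemma log_partition_sub_le (hL : ∀ x i, |v x i| ≤ L i) (β : ℝ) (ξ ξ' : ι → ℝ) :
    Real.log (partition v β ξ) - Real.log (partition v β ξ')
      ≤ ∑ i, (|β| * L i) * |ξ i - ξ' i| := by
  have hZ := partition_pos (v := v) (β := β) (ξ := ξ)
  have hZ' := partition_pos (v := v) (β := β) (ξ := ξ')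
  set T := ∑ i, (|β| * L i) * |ξ i - ξ' i|
  rw [sub_le_iff_le_add, ← Real.log_exp T, ← Real.log_mul (Real.exp_pos _).ne' hZ'.ne']
  refine Real.log_le_log hZ ?_
  unfold partition
  rw [Finset.mul_sum]
  refine Finset.sum_le_sum fun x _ => ?_
  rw [← Real.exp_add]
  refine Real.exp_le_exp.2 ?_
  rw [← sub_le_iff_le_add, ← mul_sub]
  unfold energy
  rw [← Finset.sum_sub_distrib, Finset.mul_sum]
  refine Finset.sum_le_sum fun i _ => (le_abs_self _).trans ?_
  rw [← sub_mul, abs_mul, abs_mul, mul_comm |ξ i - ξ' i|, ← mul_assoc]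
  gcongr
  exact hL x i

lemma abs_log_partition_sub_le (hL : ∀ x i, |v x i| ≤ L i) (β : ℝ) (ξ ξ' : ι → ℝ) :
    |Real.log (partition v β ξ) - Real.log (partition v β ξ')|
      ≤ ∑ i, (|β| * L i) * |ξ i - ξ' i| := by
  refine abs_sub_le_iff.2 ⟨log_partition_sub_le hL β ξ ξ', ?_⟩
  simpa only [abs_sub_comm (ξ _)] using log_partition_sub_le hL β ξ' ξ

lemma memLp_log_partition (hL : ∀ x i, |v x i| ≤ L i) (β : ℝ) :
    MemLp (fun ξ => Real.log (partition v β ξ)) 2 (stdGaussianPi ι) :=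
  memLp_of_abs_sub_le (continuous_of_abs_sub_le (abs_log_partition_sub_le hL β))
    (abs_log_partition_sub_le hL β)

lemma integral_abs_le_sqrt {Ω : Type*} [MeasurableSpace Ω] {μ : Measure Ω}
    [IsProbabilityMeasure μ] {X : Ω → ℝ} (hX : MemLp X 2 μ) :
    ∫ ω, |X ω| ∂μ ≤ √(∫ ω, X ω ^ 2 ∂μ) := by
  refine Real.le_sqrt_of_sq_le ?_
  have h := variance_nonneg (fun ω => |X ω|) μ
  have h2 : MemLp (fun ω => |X ω|) 2 μ := hX.norm
  rw [variance_eq_sub h2] at h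
  simp only [Pi.pow_apply, sq_abs] at h
  linarith

lemma integral_abs_log_partition_sub_le (hL : ∀ x i, |v x i| ≤ L i) (hLc : ∑ i, L i ^ 2 ≤ c)
    (β : ℝ) :
    ∫ ξ, |Real.log (partition v β ξ)
        - ∫ ξ', Real.log (partition v β ξ') ∂(stdGaussianPi ι)| ∂(stdGaussianPi ι)
      ≤ |β| * √c := by
  have hm := memLp_log_partition hL β
  have h := variance_stdGaussianPi_le (abs_log_partition_sub_le hL β)
  rw [variance_eq_integral hm.aemeasurable] at h
  refine (integral_abs_le_sqrt (hm.sub (memLp_const _))).trans ?_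
  refine (Real.sqrt_le_sqrt (y := |β| ^ 2 * c) ?_).trans_eq ?_
  · refine h.trans ?_
    simp_rw [mul_pow]
    rw [← Finset.mul_sum]
    gcongr
  · rw [Real.sqrt_mul (sq_nonneg _), Real.sqrt_sq (abs_nonneg _)]

lemma integral_log_partition_add_le (hL : ∀ x i, |v x i| ≤ L i) (β β' : ℝ) :
    ∫ ξ, Real.log (partition v β ξ) ∂(stdGaussianPi ι) + (β' - β) * meanEnergy v β
      ≤ ∫ ξ, Real.log (partition v β' ξ) ∂(stdGaussianPi ι) := by
  have i1 := fun b => (memLp_log_partition hL b).integrable one_le_two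
  have i2 := (integrable_internalEnergy v β).const_mul (β' - β)
  unfold meanEnergy
  rw [← integral_const_mul, ← integral_add (i1 β) i2]
  exact integral_mono ((i1 β).add i2) (i1 β') fun ξ => log_partition_add_le v β β' ξ

/-- Adding the tangent inequalities of the averaged log-partition function at the two points gives
the monotonicity of its slope. -/
lemma monotone_meanEnergy (hL : ∀ x i, |v x i| ≤ L i) : Monotone (meanEnergy v) := by
  intro a b hab
  rcases hab.eq_or_lt with rfl | h
  · exact le_rfl
  have h1 := integral_log_partition_add_le hL a b
  have h2 := integral_log_partition_add_le hL b a
  have h3 : 0 ≤ (b - a) * (meanEnergy v b - meanEnergy v a) := by linarith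
  exact sub_nonneg.1 (nonneg_of_mul_nonneg_right h3 (sub_pos.2 h))

/-- By convexity, `internalEnergy` lies between the difference quotients of `log Z` to the left and
right of `β`. Replacing `log Z` by its mean costs one deviation at each of the points `β` and `β ±
δ`, hence the `3`; the mean quotients lie between `meanEnergy` at `β - δ` and at `β + δ`. -/
lemma integral_abs_internalEnergy_sub_le (hL : ∀ x i, |v x i| ≤ L i) (hLc : ∑ i, L i ^ 2 ≤ c)
    (β : ℝ) {δ : ℝ} (hδ : 0 < δ) :
    ∫ ξ, |internalEnergy v β ξ - meanEnergy v β| ∂(stdGaussianPi ι)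
      ≤ 3 * (|β| + δ) * √c / δ + (meanEnergy v (β + δ) - meanEnergy v (β - δ)) := by
  let ψ : ℝ → (ι → ℝ) → ℝ := fun b ξ => Real.log (partition v b ξ)
  let A : ℝ → ℝ := fun b => ∫ ξ, ψ b ξ ∂(stdGaussianPi ι)
  have iφ : ∀ b, Integrable (fun ξ => |ψ b ξ - A b|) (stdGaussianPi ι) := fun b =>
    (((memLp_log_partition hL b).integrable one_le_two).sub (integrable_const _)).abs
  have hφ : ∀ b, |b| ≤ |β| + δ → ∫ ξ, |ψ b ξ - A b| ∂(stdGaussianPi ι) ≤ (|β| + δ) * √c :=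
    fun b hb => (integral_abs_log_partition_sub_le hL hLc b).trans
      (mul_le_mul_of_nonneg_right hb (Real.sqrt_nonneg _))
  have hpt : ∀ ξ, |internalEnergy v β ξ - meanEnergy v β| ≤
      (|ψ (β + δ) ξ - A (β + δ)| + |ψ β ξ - A β| + |ψ (β - δ) ξ - A (β - δ)|) * δ⁻¹
        + (meanEnergy v (β + δ) - meanEnergy v (β - δ)) := fun ξ => by
    have p1 : ψ β ξ + (β + δ - β) * internalEnergy v β ξ ≤ ψ (β + δ) ξ :=
      log_partition_add_le v β (β + δ) ξ
    have p2 : ψ β ξ + (β - δ - β) * internalEnergy v β ξ ≤ ψ (β - δ) ξ :=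
      log_partition_add_le v β (β - δ) ξ
    have q1 : A (β + δ) + (β - (β + δ)) * meanEnergy v (β + δ) ≤ A β :=
      integral_log_partition_add_le hL (β + δ) β
    have q2 : A (β - δ) + (β - (β - δ)) * meanEnergy v (β - δ) ≤ A β :=
      integral_log_partition_add_le hL (β - δ) β
    have m1 := monotone_meanEnergy hL (show β ≤ β + δ by linarith)
    have m2 := monotone_meanEnergy hL (show β - δ ≤ β by linarith)
    have m1' := mul_le_mul_of_nonneg_left m1 hδ.le
    have m2' := mul_le_mul_of_nonneg_left m2 hδ.le
    rw [← sub_le_iff_le_add, ← div_eq_mul_inv, le_div_iff₀ hδ]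
    have a1 := le_abs_self (ψ (β + δ) ξ - A (β + δ))
    have a2 := neg_abs_le (ψ β ξ - A β)
    have a3 := le_abs_self (ψ (β - δ) ξ - A (β - δ))
    have n1 := abs_nonneg (ψ (β + δ) ξ - A (β + δ))
    have n3 := abs_nonneg (ψ (β - δ) ξ - A (β - δ))
    rcases abs_cases (internalEnergy v β ξ - meanEnergy v β) with ⟨h, -⟩ | ⟨h, -⟩ <;> rw [h] <;>
      linarith
  have i2 : Integrable (fun ξ => |ψ (β + δ) ξ - A (β + δ)| + |ψ β ξ - A β|) (stdGaussianPi ι) :=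
    (iφ _).add (iφ _)
  have iR : Integrable (fun ξ =>
      (|ψ (β + δ) ξ - A (β + δ)| + |ψ β ξ - A β| + |ψ (β - δ) ξ - A (β - δ)|) * δ⁻¹)
      (stdGaussianPi ι) := (i2.add (iφ _)).mul_const _
  calc ∫ ξ, |internalEnergy v β ξ - meanEnergy v β| ∂(stdGaussianPi ι)
      ≤ ∫ ξ, ((|ψ (β + δ) ξ - A (β + δ)| + |ψ β ξ - A β| + |ψ (β - δ) ξ - A (β - δ)|) * δ⁻¹
        + (meanEnergy v (β + δ) - meanEnergy v (β - δ))) ∂(stdGaussianPi ι) :=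
        integral_mono ((integrable_internalEnergy v β).sub (integrable_const _)).abs
          (iR.add (integrable_const _)) hpt
    _ = (∫ ξ, |ψ (β + δ) ξ - A (β + δ)| ∂(stdGaussianPi ι) + ∫ ξ, |ψ β ξ - A β| ∂(stdGaussianPi ι)
          + ∫ ξ, |ψ (β - δ) ξ - A (β - δ)| ∂(stdGaussianPi ι)) * δ⁻¹
        + (meanEnergy v (β + δ) - meanEnergy v (β - δ)) := by
        rw [integral_add iR (integrable_const _), integral_mul_const,
          integral_add i2 (iφ _), integral_add (iφ _) (iφ _)]
        simp
    _ ≤ _ := by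
        have b1 := hφ (β + δ) ((abs_add_le _ _).trans_eq (by rw [abs_of_pos hδ]))
        have b2 := hφ β (by linarith)
        have b3 := hφ (β - δ) ((abs_sub _ _).trans_eq (by rw [abs_of_pos hδ]))
        rw [div_eq_mul_inv]
        gcongr
        linarith

/-- The triangle inequality through the Gibbs mean separates thermal from disorder fluctuations. The
thermal part uses `w ≤ w ^ 2 / (2 * η) + η / 2`, so that the variance enters linearly and can be
integrated over `β`. -/
lemma energyDeviation_le (hL : ∀ x i, |v x i| ≤ L i) (hLc : ∑ i, L i ^ 2 ≤ c)
    (β : ℝ) {δ η : ℝ} (hδ : 0 < δ) (hη : 0 < η) :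
    energyDeviation v β ≤ η / 2 + (∫ ξ, energyVariance v β ξ ∂(stdGaussianPi ι)) / (2 * η)
      + (3 * (|β| + δ) * √c / δ + (meanEnergy v (β + δ) - meanEnergy v (β - δ))) := by
  refine le_trans ?_ (add_le_add_right (integral_abs_internalEnergy_sub_le hL hLc β hδ) _)
  have iU : Integrable (fun ξ => |internalEnergy v β ξ - meanEnergy v β|) (stdGaussianPi ι) :=
    ((integrable_internalEnergy v β).sub (integrable_const _)).abs
  have iV : Integrable (fun ξ => η / 2 + energyVariance v β ξ / (2 * η)) (stdGaussianPi ι) :=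
    (integrable_const _).add ((integrable_energyVariance v β).div_const _)
  have hpt : ∀ ξ, gibbs v β ξ (fun x => |energy v ξ x - meanEnergy v β|) ≤
      (η / 2 + energyVariance v β ξ / (2 * η)) + |internalEnergy v β ξ - meanEnergy v β| :=
    fun ξ => by
    set u := internalEnergy v β ξ with hu
    have h1 : ∀ x, |energy v ξ x - meanEnergy v β|
        ≤ (2 * η)⁻¹ * (energy v ξ x - u) ^ 2 + (η / 2 + |u - meanEnergy v β|) := fun x => by
      have t := abs_sub_le (energy v ξ x) u (meanEnergy v β)
      have h2 : |energy v ξ x - u| ≤ (2 * η)⁻¹ * (energy v ξ x - u) ^ 2 + η / 2 := by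
        rw [← sq_abs (energy v ξ x - u)]
        set w := |energy v ξ x - u|
        have : (2 * η)⁻¹ * w ^ 2 + η / 2 - w = (2 * η)⁻¹ * (w - η) ^ 2 := by
          field_simp; ring
        have h3 : 0 ≤ (2 * η)⁻¹ * (w - η) ^ 2 := by positivity
        linarith
      linarith
    refine (gibbs_mono h1).trans_eq ?_
    rw [gibbs_add, gibbs_const_mul, gibbs_const]
    unfold energyVariance
    rw [← hu, div_eq_inv_mul (gibbs _ _ _ _)]
    ring
  unfold energyDeviation
  calc _ ≤ ∫ ξ, ((η / 2 + energyVariance v β ξ / (2 * η))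
        + |internalEnergy v β ξ - meanEnergy v β|) ∂(stdGaussianPi ι) :=
        integral_mono_of_nonneg (ae_of_all _ fun ξ => gibbs_nonneg fun _ => abs_nonneg _)
          (iV.add iU) (ae_of_all _ hpt)
    _ = _ := by
        rw [integral_add iV iU, integral_add (integrable_const _)
          ((integrable_energyVariance v β).div_const _), integral_div (2 * η)]
        simp

lemma replicas_eval (b : Fin s) (g : K → ℝ) :
    replicas v β ξ (fun X => g (X b)) = gibbs v β ξ g := by
  classical
  have h : ∀ X : Fin s → K, (∏ a, weight v β ξ (X a)) * g (X b)
      = ∏ a, weight v β ξ (X a) * if a = b then g (X a) else 1 := fun X => by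
    rw [Finset.prod_mul_distrib]
    simp
  unfold replicas
  simp only [h]
  rw [← Fintype.piFinset_univ, ← Finset.prod_univ_sum (fun _ => Finset.univ)
    (fun a x => weight v β ξ x * if a = b then g x else 1), Finset.prod_eq_single b]
  · simp [gibbs]
  · intro a _ hab
    simp [hab, sum_weight]
  · simp

/-- Integration by parts with one replica and `f = 1`: the diagonal term gives `1`, the added
replica gives the mean overlap. -/
lemma meanEnergy_eq (hR : ∀ x y, ∑ i, v x i * v y i = c * R x y) (hR1 : ∀ x, R x x = 1) (β : ℝ) :
    meanEnergy v β = β * c * (1 - quenched v β fun X : Fin 2 → K => R (X 0) (X 1)) := by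
  have h := integral_replicas_energy_mul hR β (0 : Fin 1) (fun _ => 1)
  simp only [mul_one, replicas_eval (v := v) (β := β) (0 : Fin 1) (energy v _)] at h
  change meanEnergy v β = _ at h
  rw [h]
  simp [hR1, quenched_const, Fin.last]

lemma abs_meanEnergy_le (hR : ∀ x y, ∑ i, v x i * v y i = c * R x y) (hR1 : ∀ x, R x x = 1)
    (hRb : ∀ x y, |R x y| ≤ 1) (hc : 0 ≤ c) (β : ℝ) : |meanEnergy v β| ≤ 2 * |β| * c := by
  rw [meanEnergy_eq hR hR1, abs_mul, abs_mul, abs_of_nonneg hc]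
  have h : |quenched v β fun X : Fin 2 → K => R (X 0) (X 1)| ≤ 1 :=
    abs_quenched_le fun X => hRb _ _
  have h2 : |1 - quenched v β fun X : Fin 2 → K => R (X 0) (X 1)| ≤ 2 := by
    rw [abs_le] at h ⊢; constructor <;> linarith
  nlinarith [mul_nonneg (abs_nonneg β) hc]

/-- The Ghirlanda–Guerra relation for `f` holds up to the fluctuations of the energy. -/
theorem ghirlanda_guerra_le (hR : ∀ x y, ∑ i, v x i * v y i = c * R x y) (hR1 : ∀ x, R x x = 1)
    (hc : 0 ≤ c) (hβ : 0 ≤ β) (b : Fin s) {f : (Fin s → K) → ℝ} (hf : ∀ X, |f X| ≤ 1) :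
    β * c * |∑ a, quenched v β (fun X => R (X b) (X a) * f X)
        - s * quenched v β (fun Y : Fin (s + 1) → K =>
            R (Y b.castSucc) (Y (Fin.last s)) * f (Fin.init Y))
        - (1 - quenched v β fun X : Fin 2 → K => R (X 0) (X 1)) * quenched v β f|
      ≤ energyDeviation v β := by
  have hib := integral_replicas_energy_mul hR β b f
  have hm := meanEnergy_eq hR hR1 β
  have hie : Integrable (fun ξ => replicas v β ξ (fun X => energy v ξ (X b) * f X))
      (stdGaussianPi ι) := by
    refine ((memLp_sum_abs_energy v).integrable one_le_two).mono' ?_ (ae_of_all _ fun ξ => ?_)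
    · have : Continuous fun ξ => replicas v β ξ (fun X => energy v ξ (X b) * f X) := by
        unfold replicas; fun_prop
      exact this.aestronglyMeasurable
    · refine abs_replicas_le fun X => ?_
      rw [abs_mul]
      exact (mul_le_of_le_one_right (abs_nonneg _) (hf X)).trans (abs_energy_le v ξ _)
  -- The constant `meanEnergy v β` moves inside the average; since `|f| ≤ 1`, only the deviation of
  -- the energy of replica `b` remains.
  have key : |∫ ξ, replicas v β ξ (fun X => energy v ξ (X b) * f X) ∂(stdGaussianPi ι)
      - meanEnergy v β * quenched v β f| ≤ energyDeviation v β := by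
    unfold quenched
    rw [← integral_const_mul, ← integral_sub hie ((integrable_replicas v β f).const_mul _)]
    refine (abs_integral_le_integral_abs).trans ?_
    unfold energyDeviation
    refine integral_mono_of_nonneg (ae_of_all _ fun ξ => abs_nonneg _) ?_ (ae_of_all _ fun ξ => ?_)
    · refine (((memLp_sum_abs_energy v).integrable one_le_two).add
        (integrable_const |meanEnergy v β|)).mono' ?_ (ae_of_all _ fun ξ => ?_)
      · have : Continuous fun ξ => gibbs v β ξ (fun x => |energy v ξ x - meanEnergy v β|) := by
          unfold gibbs; fun_prop
        exact this.aestronglyMeasurable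
      · refine abs_gibbs_le fun x => ?_
        rw [abs_abs]
        exact (abs_sub _ _).trans (add_le_add (abs_energy_le v ξ x) le_rfl)
    · change |replicas v β ξ (fun X => energy v ξ (X b) * f X) - meanEnergy v β *
        replicas v β ξ f| ≤ gibbs v β ξ fun x => |energy v ξ x - meanEnergy v β|
      rw [← replicas_eval (v := v) (β := β) (ξ := ξ) b
        (fun x => |energy v ξ x - meanEnergy v β|)]
      unfold replicas
      rw [Finset.mul_sum, ← Finset.sum_sub_distrib]
      refine (Finset.abs_sum_le_sum_abs _ _).trans (Finset.sum_le_sum fun X _ => ?_)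
      have e : (∏ a, weight v β ξ (X a)) * (energy v ξ (X b) * f X)
          - meanEnergy v β * ((∏ a, weight v β ξ (X a)) * f X)
          = (∏ a, weight v β ξ (X a)) * ((energy v ξ (X b) - meanEnergy v β) * f X) := by ring
      rw [e, abs_mul, abs_of_nonneg (prod_weight_nonneg X), abs_mul]
      exact mul_le_mul_of_nonneg_left (mul_le_of_le_one_right (abs_nonneg _) (hf X))
        (prod_weight_nonneg X)
  refine le_trans (le_of_eq ?_) key
  rw [hib, hm, mul_assoc (β * c), ← mul_sub, abs_mul (β * c), abs_of_nonneg (mul_nonneg hβ hc)]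

end Concentration

/-! ### Averaging over the inverse temperature -/

section Averaging

lemma intervalIntegral_indicator_Iio_le {B ε : ℝ} (hB : 0 ≤ B) (hε : 0 ≤ ε) :
    ∫ β in (0 : ℝ)..B, (Set.Iio ε).indicator (fun _ => (1 : ℝ)) β ≤ ε := by
  rw [intervalIntegral.integral_of_le hB, integral_indicator measurableSet_Iio,
    Measure.restrict_restrict measurableSet_Iio, setIntegral_const, smul_eq_mul, mul_one]
  have h : Set.Iio ε ∩ Set.Ioc 0 B ⊆ Set.Ioc 0 ε := fun x hx => ⟨hx.2.1, le_of_lt hx.1⟩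
  refine (measureReal_mono h (by simp)).trans_eq ?_
  simp [hε]

/-- The shifted integrals cancel except on two windows of length `2 * δ`, around `B` and around `0`,
where monotonicity bounds `m` by an endpoint value. -/
lemma intervalIntegral_add_sub_sub_le {m : ℝ → ℝ} (hm : Monotone m) {δ : ℝ} (hδ : 0 ≤ δ) (B : ℝ) :
    ∫ β in (0 : ℝ)..B, (m (β + δ) - m (β - δ)) ≤ 2 * δ * (m (B + δ) - m (-δ)) := by
  have hi : ∀ a b, IntervalIntegrable m volume a b := fun a b => hm.intervalIntegrable
  have h1 : Monotone fun β => m (β + δ) := fun a b hab => hm (by linarith)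
  have h2 : Monotone fun β => m (β - δ) := fun a b hab => hm (by linarith)
  rw [intervalIntegral.integral_sub h1.intervalIntegrable h2.intervalIntegrable,
    intervalIntegral.integral_comp_add_right, intervalIntegral.integral_comp_sub_right,
    intervalIntegral.integral_interval_sub_interval_comm (hi _ _) (hi _ _) (hi _ _),
    intervalIntegral.integral_symm, intervalIntegral.integral_symm (B - δ)]
  have e1 : ∫ x in (B - δ)..(B + δ), m x ≤ 2 * δ * m (B + δ) := by
    refine (intervalIntegral.integral_mono_on (by linarith) (hi _ _)
      (intervalIntegrable_const (c := m (B + δ))) fun x hx => hm hx.2).trans_eq ?_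
    rw [intervalIntegral.integral_const, smul_eq_mul]
    ring
  have e2 : 2 * δ * m (-δ) ≤ ∫ x in (0 - δ)..(0 + δ), m x := by
    refine le_trans (le_of_eq ?_) (intervalIntegral.integral_mono_on (by linarith)
      (intervalIntegrable_const (c := m (-δ))) (hi _ _) fun x hx => hm (by linarith [hx.1]))
    rw [intervalIntegral.integral_const, smul_eq_mul]
    ring
  linarith

variable {ι K : Type*} [Fintype ι] [Fintype K] [Nonempty K]
  {v : K → ι → ℝ} {c : ℝ} {R : K → K → ℝ} {L : ι → ℝ}

/-- A function controlled by the fluctuations of the energy is small in average over `β`. -/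
theorem intervalIntegral_abs_le (hR : ∀ x y, ∑ i, v x i * v y i = c * R x y)
    (hR1 : ∀ x, R x x = 1) (hRb : ∀ x y, |R x y| ≤ 1) (hL : ∀ x i, |v x i| ≤ L i)
    (hLc : ∑ i, L i ^ 2 ≤ c) (hc : 0 < c) {G : ℝ → ℝ} (hG : ∀ β, |G β| ≤ 4)
    (hGD : ∀ β, 0 ≤ β → β * c * |G β| ≤ energyDeviation v β) {a B : ℝ} (ha : 0 ≤ a) (haB : a ≤ B)
    {ε δ η : ℝ} (hε : 0 < ε) (hδ : 0 < δ) (hη : 0 < η) :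
    ∫ β in a..B, |G β| ≤ 4 * ε + (ε * c)⁻¹ * (B * η / 2 + B * c / η
      + 3 * B * (B + δ) * √c / δ + 4 * c * δ * (B + 2 * δ)) := by
  have hB : 0 ≤ B := ha.trans haB
  let V : ℝ → ℝ := fun β => ∫ ξ, energyVariance v β ξ ∂(stdGaussianPi ι)
  let m := meanEnergy v
  have hm : Monotone m := monotone_meanEnergy hL
  let I : ℝ → ℝ := (Set.Iio ε).indicator fun _ => (1 : ℝ)
  let Ψ : ℝ → ℝ := fun β => η / 2 + V β / (2 * η) + (3 * (B + δ) * √c / δ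
    + (m (β + δ) - m (β - δ)))
  have hΨ : ∀ β, 0 ≤ β → β ≤ B → energyDeviation v β ≤ Ψ β := fun β h0 hβ => by
    refine (energyDeviation_le hL hLc β hδ hη).trans ?_
    rw [abs_of_nonneg h0]
    simp only [Ψ, V, m]
    gcongr
  have hD0 : ∀ β, 0 ≤ energyDeviation v β := fun β =>
    integral_nonneg fun ξ => gibbs_nonneg fun _ => abs_nonneg _
  have hI0 : ∀ β, 0 ≤ I β := fun β => Set.indicator_nonneg (fun _ _ => zero_le_one) β
  have hεc : 0 < ε * c := mul_pos hε hc
  -- Below `ε` the trivial bound `4` is used; above it `β * c ≥ ε * c` can be divided out.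
  have hpt : ∀ β, 0 ≤ β → β ≤ B → |G β| ≤ 4 * I β + (ε * c)⁻¹ * Ψ β := fun β h0 hβ => by
    have h1 := hΨ β h0 hβ
    by_cases h : β < ε
    · have : I β = 1 := Set.indicator_of_mem (s := Set.Iio ε) h _
      have h2 : 0 ≤ (ε * c)⁻¹ * Ψ β :=
        mul_nonneg (inv_nonneg.2 hεc.le) ((hD0 β).trans h1)
      have := hG β
      linarith
    · have h2 : |G β| ≤ (ε * c)⁻¹ * Ψ β := by
        rw [inv_mul_eq_div, le_div_iff₀ hεc, mul_comm]
        refine le_trans ?_ ((hGD β h0).trans h1)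
        gcongr
        exact not_lt.1 h
      linarith [hI0 β]
  have iI : IntervalIntegrable I volume 0 B :=
    (intervalIntegrable_const (c := (1 : ℝ))).mono_fun
      ((measurable_const.indicator measurableSet_Iio).aestronglyMeasurable)
      (ae_of_all _ fun β => by
        simp only [I]
        exact norm_indicator_le_norm_self (s := Set.Iio ε) (fun _ => (1 : ℝ)) β)
  have iV : IntervalIntegrable V volume 0 B := by
    rw [intervalIntegrable_iff]
    exact (integrable_uncurry_energyVariance v 0 B).integral_prod_left
  have im : IntervalIntegrable (fun β => m (β + δ) - m (β - δ)) volume 0 B :=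
    (show Monotone fun β => m (β + δ) from fun _ _ h => hm (by linarith)).intervalIntegrable.sub
      (show Monotone fun β => m (β - δ) from fun _ _ h => hm (by linarith)).intervalIntegrable
  have i1 : IntervalIntegrable (fun β => η / 2 + V β / (2 * η)) volume 0 B :=
    intervalIntegrable_const.add (iV.div_const _)
  have i2 : IntervalIntegrable (fun β => 3 * (B + δ) * √c / δ + (m (β + δ) - m (β - δ)))
      volume 0 B := intervalIntegrable_const.add im
  have iΨ : IntervalIntegrable Ψ volume 0 B := i1.add i2
  have iΦ : IntervalIntegrable (fun β => 4 * I β + (ε * c)⁻¹ * Ψ β) volume 0 B :=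
    (iI.const_mul 4).add (iΨ.const_mul _)
  have hsub : Set.Ioc a B ⊆ Set.Ioc 0 B := Set.Ioc_subset_Ioc_left ha
  have hmB := abs_meanEnergy_le hR hR1 hRb hc.le B
  have hm1 := abs_meanEnergy_le hR hR1 hRb hc.le (B + δ)
  have hm2 := abs_meanEnergy_le hR hR1 hRb hc.le (-δ)
  have hm0 := abs_meanEnergy_le hR hR1 hRb hc.le 0
  rw [abs_of_nonneg hB] at hmB
  rw [abs_of_nonneg (add_nonneg hB hδ.le)] at hm1
  rw [abs_neg, abs_of_pos hδ] at hm2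
  rw [abs_zero, mul_zero, zero_mul] at hm0
  -- The integral is `m B - m 0`, and the mean energy vanishes at `β = 0`.
  have hVint : ∫ β in (0 : ℝ)..B, V β ≤ 2 * B * c := by
    rw [integral_energyVariance v 0 B]
    have := abs_le.1 hmB
    have := abs_le.1 hm0
    linarith
  have hmint : ∫ β in (0 : ℝ)..B, (m (β + δ) - m (β - δ)) ≤ 4 * c * δ * (B + 2 * δ) := by
    refine (intervalIntegral_add_sub_sub_le hm hδ.le B).trans ?_
    have h1 := (abs_le.1 hm1).2
    have h2 := (abs_le.1 hm2).1
    calc 2 * δ * (m (B + δ) - m (-δ)) ≤ 2 * δ * (2 * (B + δ) * c + 2 * δ * c) := by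
          have : m (B + δ) - m (-δ) ≤ 2 * (B + δ) * c + 2 * δ * c := by
            simp only [m]; linarith
          gcongr
      _ = _ := by ring
  calc ∫ β in a..B, |G β|
      ≤ ∫ β in Set.Ioc a B, (4 * I β + (ε * c)⁻¹ * Ψ β) := by
        rw [intervalIntegral.integral_of_le haB]
        refine integral_mono_of_nonneg (ae_of_all _ fun _ => abs_nonneg _)
          (((intervalIntegrable_iff_integrableOn_Ioc_of_le hB).1 iΦ).mono_set hsub) ?_
        filter_upwards [ae_restrict_mem measurableSet_Ioc] with β hβ
        exact hpt β (ha.trans hβ.1.le) hβ.2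
    _ ≤ ∫ β in Set.Ioc 0 B, (4 * I β + (ε * c)⁻¹ * Ψ β) := by
        refine setIntegral_mono_set ((intervalIntegrable_iff_integrableOn_Ioc_of_le hB).1 iΦ) ?_
          hsub.eventuallyLE
        filter_upwards [ae_restrict_mem measurableSet_Ioc] with β hβ
        exact (abs_nonneg _).trans (hpt β hβ.1.le hβ.2)
    _ = 4 * (∫ β in (0 : ℝ)..B, I β) + (ε * c)⁻¹ * (B * η / 2 + (∫ β in (0 : ℝ)..B, V β) / (2 * η)
          + (B * (3 * (B + δ) * √c / δ) + ∫ β in (0 : ℝ)..B, (m (β + δ) - m (β - δ)))) := by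
        rw [← intervalIntegral.integral_of_le hB,
          intervalIntegral.integral_add (iI.const_mul 4) (iΨ.const_mul _),
          intervalIntegral.integral_const_mul, intervalIntegral.integral_const_mul]
        simp only [Ψ]
        rw [intervalIntegral.integral_add i1 i2,
          intervalIntegral.integral_add intervalIntegrable_const (iV.div_const _),
          intervalIntegral.integral_add intervalIntegrable_const im,
          intervalIntegral.integral_const, intervalIntegral.integral_const,
          intervalIntegral.integral_div]
        simp only [smul_eq_mul, sub_zero, mul_div_assoc]
    _ ≤ 4 * ε + (ε * c)⁻¹ * (B * η / 2 + 2 * B * c / (2 * η)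
          + (B * (3 * (B + δ) * √c / δ) + 4 * c * δ * (B + 2 * δ))) := by
        have hI := intervalIntegral_indicator_Iio_le hB hε.le
        gcongr
    _ = _ := by
        congr 2
        field_simp
        ring

/-- The bound of `intervalIntegral_abs_le` at an optimized choice of the parameters. -/
lemma intervalIntegral_abs_le_of_scale (hR : ∀ x y, ∑ i, v x i * v y i = c * R x y)
    (hR1 : ∀ x, R x x = 1) (hRb : ∀ x y, |R x y| ≤ 1) (hL : ∀ x i, |v x i| ≤ L i)
    (hLc : ∑ i, L i ^ 2 ≤ c) {r : ℝ} (hr : 0 < r) (hcr : c = (r ^ 8)⁻¹) {G : ℝ → ℝ}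
    (hG : ∀ β, |G β| ≤ 4) (hGD : ∀ β, 0 ≤ β → β * c * |G β| ≤ energyDeviation v β)
    {a B : ℝ} (ha : 0 ≤ a) (haB : a ≤ B) :
    ∫ β in a..B, |G β| ≤ 4 * r + 3 / 2 * B * r ^ 3 + 3 * B * (B + r ^ 2) * r
      + 4 * r * (B + 2 * r ^ 2) := by
  have hc : 0 < c := by rw [hcr]; positivity
  have hs : √c = (r ^ 4)⁻¹ := by
    rw [hcr, show (r ^ 8)⁻¹ = ((r ^ 4)⁻¹) ^ 2 by field_simp, Real.sqrt_sq (by positivity)]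
  -- Here `ε = r`, `δ = r ^ 2` and `η = r ^ (-4) = √c`. The small-`β`, log-partition and increment
  -- terms are then all of order `r`, and the thermal terms of order `r ^ 3`.
  refine (intervalIntegral_abs_le hR hR1 hRb hL hLc hc hG hGD ha haB hr
    (pow_pos hr 2) (inv_pos.2 (pow_pos hr 4))).trans_eq ?_
  rw [hs, hcr]
  field_simp
  ring

/-- The case of two replicas, `b = 1` and `f = R₀₁`: the self-overlap term `⟨R₀₁⟩` cancels the
linear part of `(1 - ⟨R₀₁⟩) * ⟨R₀₁⟩`, leaving the square. -/
lemma ghirlanda_guerra_12_23_le (hR : ∀ x y, ∑ i, v x i * v y i = c * R x y)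
    (hR1 : ∀ x, R x x = 1) (hRb : ∀ x y, |R x y| ≤ 1) (hRs : ∀ x y, R x y = R y x) (hc : 0 ≤ c)
    {β : ℝ} (hβ : 0 ≤ β) :
    β * c * |(quenched v β fun X : Fin 2 → K => R (X 0) (X 1) ^ 2)
      - 2 * (quenched v β fun X : Fin 3 → K => R (X 0) (X 1) * R (X 1) (X 2))
      + (quenched v β fun X : Fin 2 → K => R (X 0) (X 1)) ^ 2| ≤ energyDeviation v β := by
  refine le_trans (le_of_eq ?_) (ghirlanda_guerra_le hR hR1 hc hβ (1 : Fin 2)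
    (f := fun X => R (X 0) (X 1)) fun X => hRb _ _)
  congr 2
  have e1 : (fun X : Fin 2 → K => R (X 1) (X 0) * R (X 0) (X 1))
      = fun X => R (X 0) (X 1) ^ 2 := by
    ext X; rw [hRs (X 1)]; ring
  have e2 : (fun Y : Fin 3 → K => R (Y (Fin.castSucc 1)) (Y (Fin.last 2))
      * R ((Fin.init Y : Fin 2 → K) 0) ((Fin.init Y : Fin 2 → K) 1))
      = fun X => R (X 0) (X 1) * R (X 1) (X 2) := by
    ext X; exact mul_comm _ _
  rw [Fin.sum_univ_two, e1, e2]
  simp only [hR1, one_mul, Nat.cast_ofNat]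
  ring

/-- The case of three replicas with `b = 2` outside the pair in `f = R₀₁`: both off-diagonal terms
share one replica with that pair, and the added replica produces the disjoint pair. -/
lemma ghirlanda_guerra_12_34_le (hR : ∀ x y, ∑ i, v x i * v y i = c * R x y)
    (hR1 : ∀ x, R x x = 1) (hRb : ∀ x y, |R x y| ≤ 1) (hRs : ∀ x y, R x y = R y x) (hc : 0 ≤ c)
    {β : ℝ} (hβ : 0 ≤ β) :
    β * c * |2 * (quenched v β fun X : Fin 3 → K => R (X 0) (X 1) * R (X 1) (X 2))
      - 3 * (quenched v β fun X : Fin 4 → K => R (X 0) (X 1) * R (X 2) (X 3))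
      + (quenched v β fun X : Fin 2 → K => R (X 0) (X 1)) ^ 2| ≤ energyDeviation v β := by
  refine le_trans (le_of_eq ?_) (ghirlanda_guerra_le hR hR1 hc hβ (2 : Fin 3)
    (f := fun X => R (X 0) (X 1)) fun X => hRb _ _)
  congr 2
  -- Exchanging replicas `0` and `1` makes `1` the shared replica.
  have e0 : (quenched v β fun X : Fin 3 → K => R (X 2) (X 0) * R (X 0) (X 1))
      = quenched v β fun X : Fin 3 → K => R (X 0) (X 1) * R (X 1) (X 2) := by
    rw [← quenched_comp_perm (Equiv.swap (0 : Fin 3) 1)]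
    congr 1
    ext X
    simp only [Function.comp_apply, Equiv.swap_apply_left, Equiv.swap_apply_right,
      Equiv.swap_apply_of_ne_of_ne (show (2 : Fin 3) ≠ 0 by decide)
        (show (2 : Fin 3) ≠ 1 by decide)]
    rw [hRs (X 2), hRs (X 1) (X 0), mul_comm]
  have e1 : (fun X : Fin 3 → K => R (X 2) (X 1) * R (X 0) (X 1))
      = fun X => R (X 0) (X 1) * R (X 1) (X 2) := by
    ext X; rw [hRs (X 2), mul_comm]
  have e2 : (fun Y : Fin 4 → K => R (Y (Fin.castSucc 2)) (Y (Fin.last 3))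
      * R ((Fin.init Y : Fin 3 → K) 0) ((Fin.init Y : Fin 3 → K) 1))
      = fun X => R (X 0) (X 1) * R (X 2) (X 3) := by
    ext X; exact mul_comm _ _
  have e3 : (quenched v β fun X : Fin 3 → K => R (X 0) (X 1))
      = quenched v β fun X : Fin 2 → K => R (X 0) (X 1) :=
    quenched_init (v := v) (β := β) fun X : Fin 2 → K => R (X 0) (X 1)
  rw [Fin.sum_univ_three, e0, e1, e2]
  simp only [hR1, one_mul, Nat.cast_ofNat, e3]
  ring

end Averaging

end GaussianGibbs

/-! ### The bipartite model and the thermodynamic limit -/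

open BipartiteSpinGlass
namespace BipartiteSpinGlass

open GaussianGibbs

/-- The coefficients of the bipartite energy `-H` in the couplings. -/
noncomputable def couplingVector (N₁ N₂ : ℕ) (x : Config N₁ N₂) (i : Fin N₁ × Fin N₂) : ℝ :=
  √(2 / ((N₁ : ℝ) + (N₂ : ℝ))) * (spin (x.1 i.1) * spin (x.2 i.2))

/-- The product `q p` of the overlaps of two configurations. -/
noncomputable def overlapProd (N₁ N₂ : ℕ) (x y : Config N₁ N₂) : ℝ :=
  ((∑ i : Fin N₁, spin (x.1 i) * spin (y.1 i)) / (N₁ : ℝ)) *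
    ((∑ j : Fin N₂, spin (x.2 j) * spin (y.2 j)) / (N₂ : ℝ))

/-- The variance of the bipartite energy. -/
noncomputable def energyScale (N₁ N₂ : ℕ) : ℝ := 2 * N₁ * N₂ / ((N₁ : ℝ) + (N₂ : ℝ))

lemma spin_mul_self (s : ℤˣ) : spin s * spin s = 1 := by
  rcases Int.units_eq_one_or s with rfl | rfl <;> simp [spin]

lemma abs_spin (s : ℤˣ) : |spin s| = 1 := by
  rcases Int.units_eq_one_or s with rfl | rfl <;> simp [spin]

variable {N₁ N₂ s : ℕ}

lemma energy_couplingVector (ξ : Disorder N₁ N₂) (x : Config N₁ N₂) :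
    energy (couplingVector N₁ N₂) ξ x = -hamiltonian ξ x := by
  unfold energy hamiltonian couplingVector
  rw [neg_mul, neg_neg, Finset.mul_sum, Fintype.sum_prod_type]
  refine Finset.sum_congr rfl fun i _ => ?_
  rw [Finset.mul_sum]
  exact Finset.sum_congr rfl fun j _ => by ring

lemma quenchedAverage_eq_quenched (β : ℝ) (F : (Fin s → Config N₁ N₂) → ℝ) :
    quenchedAverage β F = quenched (couplingVector N₁ N₂) β F := by
  have h : ∀ (ξ : Disorder N₁ N₂) x, boltzmannWeight β ξ x
      = weight (couplingVector N₁ N₂) β ξ x := fun ξ x => by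
    unfold boltzmannWeight weight partitionFunction partition
    simp only [energy_couplingVector, neg_mul, mul_neg]
  unfold quenchedAverage quenched productState replicas
  simp only [h]
  rfl

lemma avgQP_eq (β : ℝ) : avgQP N₁ N₂ β = quenched (couplingVector N₁ N₂) β
    fun X : Fin 2 → Config N₁ N₂ => overlapProd N₁ N₂ (X 0) (X 1) :=
  quenchedAverage_eq_quenched _ _

lemma avgQPsq_eq (β : ℝ) : avgQPsq N₁ N₂ β = quenched (couplingVector N₁ N₂) β
    fun X : Fin 2 → Config N₁ N₂ => overlapProd N₁ N₂ (X 0) (X 1) ^ 2 := by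
  simp only [overlapProd, mul_pow]
  exact quenchedAverage_eq_quenched _ _

lemma avgQP12QP23_eq (β : ℝ) : avgQP12QP23 N₁ N₂ β = quenched (couplingVector N₁ N₂) β
    fun X : Fin 3 → Config N₁ N₂ =>
      overlapProd N₁ N₂ (X 0) (X 1) * overlapProd N₁ N₂ (X 1) (X 2) := by
  simp only [overlapProd, ← mul_assoc]
  exact quenchedAverage_eq_quenched _ _

lemma avgQP12QP34_eq (β : ℝ) : avgQP12QP34 N₁ N₂ β = quenched (couplingVector N₁ N₂) β
    fun X : Fin 4 → Config N₁ N₂ =>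
      overlapProd N₁ N₂ (X 0) (X 1) * overlapProd N₁ N₂ (X 2) (X 3) := by
  simp only [overlapProd, ← mul_assoc]
  exact quenchedAverage_eq_quenched _ _

/-- The double sum over couplings factorizes into a sum over each party, which is why the covariance
is the product of the two overlaps. -/
lemma sum_couplingVector_mul (h₁ : 0 < N₁) (h₂ : 0 < N₂) (x y : Config N₁ N₂) :
    ∑ i, couplingVector N₁ N₂ x i * couplingVector N₁ N₂ y i
      = energyScale N₁ N₂ * overlapProd N₁ N₂ x y := by
  have h₁' : (0 : ℝ) < N₁ := Nat.cast_pos.2 h₁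
  have h₂' : (0 : ℝ) < N₂ := Nat.cast_pos.2 h₂
  have hs : √(2 / ((N₁ : ℝ) + N₂)) * √(2 / ((N₁ : ℝ) + N₂)) = 2 / ((N₁ : ℝ) + N₂) :=
    Real.mul_self_sqrt (by positivity)
  have e : ∑ i, couplingVector N₁ N₂ x i * couplingVector N₁ N₂ y i
      = 2 / ((N₁ : ℝ) + N₂) * ((∑ i, spin (x.1 i) * spin (y.1 i))
        * ∑ j, spin (x.2 j) * spin (y.2 j)) := by
    rw [Finset.sum_mul_sum, Fintype.sum_prod_type, Finset.mul_sum]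
    refine Finset.sum_congr rfl fun i _ => ?_
    rw [Finset.mul_sum]
    refine Finset.sum_congr rfl fun j _ => ?_
    rw [← hs]
    unfold couplingVector
    ring
  rw [e]
  unfold energyScale overlapProd
  field_simp

lemma overlapProd_self (h₁ : 0 < N₁) (h₂ : 0 < N₂) (x : Config N₁ N₂) :
    overlapProd N₁ N₂ x x = 1 := by
  have h₁' : (N₁ : ℝ) ≠ 0 := (Nat.cast_pos.2 h₁).ne'
  have h₂' : (N₂ : ℝ) ≠ 0 := (Nat.cast_pos.2 h₂).ne'
  simp [overlapProd, spin_mul_self, h₁', h₂']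

lemma overlapProd_comm (x y : Config N₁ N₂) :
    overlapProd N₁ N₂ x y = overlapProd N₁ N₂ y x := by
  simp only [overlapProd, mul_comm (spin (x.1 _)), mul_comm (spin (x.2 _))]

lemma abs_sum_spin_div_le {n : ℕ} (f g : Fin n → ℤˣ) :
    |(∑ i, spin (f i) * spin (g i)) / (n : ℝ)| ≤ 1 := by
  rw [abs_div, Nat.abs_cast]
  refine div_le_one_of_le₀ ((Finset.abs_sum_le_sum_abs _ _).trans_eq ?_) (Nat.cast_nonneg _)
  simp [abs_mul, abs_spin]

lemma abs_overlapProd_le (x y : Config N₁ N₂) : |overlapProd N₁ N₂ x y| ≤ 1 := by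
  unfold overlapProd
  rw [abs_mul]
  exact mul_le_one₀ (abs_sum_spin_div_le _ _) (abs_nonneg _) (abs_sum_spin_div_le _ _)

lemma abs_couplingVector_le (x : Config N₁ N₂) (i : Fin N₁ × Fin N₂) :
    |couplingVector N₁ N₂ x i| ≤ √(2 / ((N₁ : ℝ) + (N₂ : ℝ))) := by
  unfold couplingVector
  rw [abs_mul, abs_mul, abs_spin, abs_spin, abs_of_nonneg (Real.sqrt_nonneg _)]
  simp

lemma sum_sq_coupling (N₁ N₂ : ℕ) :
    ∑ _i : Fin N₁ × Fin N₂, √(2 / ((N₁ : ℝ) + (N₂ : ℝ))) ^ 2 ≤ energyScale N₁ N₂ := by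
  rw [Real.sq_sqrt (by positivity)]
  simp only [Finset.sum_const, Finset.card_univ, Fintype.card_prod, Fintype.card_fin,
    nsmul_eq_mul, Nat.cast_mul]
  exact le_of_eq (by unfold energyScale; ring)

/-- The deviation from the relation for `⟨q₁₂ p₁₂ q₂₃ p₂₃⟩`. -/
noncomputable def defect23 (N₁ N₂ : ℕ) (β : ℝ) : ℝ :=
  avgQP12QP23 N₁ N₂ β - (1 / 2 * avgQPsq N₁ N₂ β + 1 / 2 * avgQP N₁ N₂ β ^ 2)

/-- The deviation from the relation for `⟨q₁₂ p₁₂ q₃₄ p₃₄⟩`. -/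
noncomputable def defect34 (N₁ N₂ : ℕ) (β : ℝ) : ℝ :=
  avgQP12QP34 N₁ N₂ β - (1 / 3 * avgQPsq N₁ N₂ β + 2 / 3 * avgQP N₁ N₂ β ^ 2)

lemma abs_avgQP_le (β : ℝ) : |avgQP N₁ N₂ β| ≤ 1 := by
  rw [avgQP_eq]
  exact abs_quenched_le fun X => abs_overlapProd_le _ _

lemma abs_avgQPsq_le (β : ℝ) : |avgQPsq N₁ N₂ β| ≤ 1 := by
  rw [avgQPsq_eq]
  exact abs_quenched_le fun X => by
    rw [abs_pow]; exact pow_le_one₀ (abs_nonneg _) (abs_overlapProd_le _ _)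

lemma abs_avgQP12QP23_le (β : ℝ) : |avgQP12QP23 N₁ N₂ β| ≤ 1 := by
  rw [avgQP12QP23_eq]
  exact abs_quenched_le fun X => by
    rw [abs_mul]
    exact mul_le_one₀ (abs_overlapProd_le _ _) (abs_nonneg _) (abs_overlapProd_le _ _)

lemma abs_avgQP12QP34_le (β : ℝ) : |avgQP12QP34 N₁ N₂ β| ≤ 1 := by
  rw [avgQP12QP34_eq]
  exact abs_quenched_le fun X => by
    rw [abs_mul]
    exact mul_le_one₀ (abs_overlapProd_le _ _) (abs_nonneg _) (abs_overlapProd_le _ _)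

lemma abs_defect_le (β : ℝ) : |defect23 N₁ N₂ β| ≤ 4 ∧ |defect34 N₁ N₂ β| ≤ 4 := by
  have h1 := abs_avgQP_le (N₁ := N₁) (N₂ := N₂) β
  have h2 := abs_le.1 (abs_avgQPsq_le (N₁ := N₁) (N₂ := N₂) β)
  have h3 := abs_le.1 (abs_avgQP12QP23_le (N₁ := N₁) (N₂ := N₂) β)
  have h4 := abs_le.1 (abs_avgQP12QP34_le (N₁ := N₁) (N₂ := N₂) β)
  have h5 : avgQP N₁ N₂ β ^ 2 ≤ 1 := (sq_le_one_iff_abs_le_one _).2 h1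
  have h6 := sq_nonneg (avgQP N₁ N₂ β)
  unfold defect23 defect34
  constructor <;> rw [abs_le] <;> constructor <;> linarith

lemma energyScale_nonneg (N₁ N₂ : ℕ) : 0 ≤ energyScale N₁ N₂ := by
  unfold energyScale; positivity

/-- Up to sign, the first defect is half of the two-replica relation, and the second is a third of
the sum of the two relations, in which `⟨R₁₂ R₂₃⟩` cancels. -/
lemma defect_le_energyDeviation (h₁ : 0 < N₁) (h₂ : 0 < N₂) {β : ℝ} (hβ : 0 ≤ β) :
    β * energyScale N₁ N₂ * |defect23 N₁ N₂ β| ≤ energyDeviation (couplingVector N₁ N₂) β ∧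
    β * energyScale N₁ N₂ * |defect34 N₁ N₂ β| ≤ energyDeviation (couplingVector N₁ N₂) β := by
  have g1 := ghirlanda_guerra_12_23_le (sum_couplingVector_mul h₁ h₂) (overlapProd_self h₁ h₂)
    abs_overlapProd_le overlapProd_comm (energyScale_nonneg N₁ N₂) hβ
  have g2 := ghirlanda_guerra_12_34_le (sum_couplingVector_mul h₁ h₂) (overlapProd_self h₁ h₂)
    abs_overlapProd_le overlapProd_comm (energyScale_nonneg N₁ N₂) hβ
  rw [← avgQP_eq, ← avgQPsq_eq, ← avgQP12QP23_eq] at g1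
  rw [← avgQP_eq, ← avgQP12QP23_eq, ← avgQP12QP34_eq] at g2
  set T := β * energyScale N₁ N₂
  have hT : 0 ≤ T := mul_nonneg hβ (energyScale_nonneg N₁ N₂)
  unfold defect23 defect34
  generalize avgQP N₁ N₂ β = A at *
  generalize avgQPsq N₁ N₂ β = S at *
  generalize avgQP12QP23 N₁ N₂ β = P at *
  generalize avgQP12QP34 N₁ N₂ β = Q at *
  have a1 : |P - (1 / 2 * S + 1 / 2 * A ^ 2)| = 1 / 2 * |S - 2 * P + A ^ 2| := by
    rw [← abs_of_pos (show (0 : ℝ) < 1 / 2 by norm_num), ← abs_mul, abs_of_pos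
      (show (0 : ℝ) < 1 / 2 by norm_num), ← abs_neg]
    congr 1; ring
  have a2 : |Q - (1 / 3 * S + 2 / 3 * A ^ 2)| ≤
      1 / 3 * |S - 2 * P + A ^ 2| + 1 / 3 * |2 * P - 3 * Q + A ^ 2| := by
    have h1 := neg_abs_le (S - 2 * P + A ^ 2)
    have h2 := le_abs_self (S - 2 * P + A ^ 2)
    have h3 := neg_abs_le (2 * P - 3 * Q + A ^ 2)
    have h4 := le_abs_self (2 * P - 3 * Q + A ^ 2)
    rw [abs_le]
    constructor <;> linarith
  have a2' := mul_le_mul_of_nonneg_left a2 hT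
  have t1 : 0 ≤ T * |S - 2 * P + A ^ 2| := mul_nonneg hT (abs_nonneg _)
  rw [a1]
  constructor <;> linarith

/-- The scale is `2 * N₂` times the ratio that converges to `α > 0`. -/
lemma tendsto_energyScale {α : ℝ} (hα : 0 < α) {N₁ N₂ : ℕ → ℕ} (hN₂ : Tendsto N₂ atTop atTop)
    (hratio : Tendsto (fun n => (N₁ n : ℝ) / ((N₁ n : ℝ) + (N₂ n : ℝ))) atTop (𝓝 α)) :
    Tendsto (fun n => energyScale (N₁ n) (N₂ n)) atTop atTop := by
  have h : Tendsto (fun n => (N₂ n : ℝ)) atTop atTop := tendsto_natCast_atTop_atTop.comp hN₂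
  have h2 := (hratio.const_mul 2).pos_mul_atTop (by positivity) h
  refine h2.congr fun n => ?_
  unfold energyScale
  ring

lemma tendsto_intervalIntegral_defect {α : ℝ} (hα : 0 < α) {N₁ N₂ : ℕ → ℕ}
    (hN₁ : Tendsto N₁ atTop atTop) (hN₂ : Tendsto N₂ atTop atTop)
    (hratio : Tendsto (fun n => (N₁ n : ℝ) / ((N₁ n : ℝ) + (N₂ n : ℝ))) atTop (𝓝 α))
    {β₁ β₂ : ℝ} (hβ₁ : 0 ≤ β₁) (hβ : β₁ ≤ β₂) {G : ℕ → ℕ → ℝ → ℝ}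
    (hG : ∀ M₁ M₂ β, |G M₁ M₂ β| ≤ 4)
    (hGD : ∀ M₁ M₂ β, 0 < M₁ → 0 < M₂ → 0 ≤ β →
      β * energyScale M₁ M₂ * |G M₁ M₂ β| ≤ energyDeviation (couplingVector M₁ M₂) β) :
    Tendsto (fun n => ∫ β in β₁..β₂, |G (N₁ n) (N₂ n) β|) atTop (𝓝 0) := by
  have hc := tendsto_energyScale hα hN₂ hratio
  -- Solves `c = (r ^ 8)⁻¹`; the bound is then a polynomial in `r` vanishing at `0`.
  let r : ℕ → ℝ := fun n => energyScale (N₁ n) (N₂ n) ^ (-(1 / 8 : ℝ))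
  have hr : Tendsto r atTop (𝓝 0) := (tendsto_rpow_neg_atTop (by norm_num)).comp hc
  let p : ℝ → ℝ := fun r => 4 * r + 3 / 2 * β₂ * r ^ 3 + 3 * β₂ * (β₂ + r ^ 2) * r
    + 4 * r * (β₂ + 2 * r ^ 2)
  have hp : Tendsto (fun n => p (r n)) atTop (𝓝 0) := by
    have hcont : Continuous p := by fun_prop
    have h0 : p 0 = 0 := by simp [p]
    have := (hcont.tendsto 0).comp hr
    rwa [h0] at this
  refine squeeze_zero' (Eventually.of_forall fun n =>
    intervalIntegral.integral_nonneg hβ fun _ _ => abs_nonneg _) ?_ hp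
  filter_upwards [hN₁.eventually_gt_atTop 0, hN₂.eventually_gt_atTop 0,
    hc.eventually_gt_atTop 0] with n h₁ h₂ hcn
  refine intervalIntegral_abs_le_of_scale (sum_couplingVector_mul h₁ h₂) (overlapProd_self h₁ h₂)
    abs_overlapProd_le abs_couplingVector_le (sum_sq_coupling _ _)
    (Real.rpow_pos_of_pos hcn _) ?_ (hG _ _) (fun β h0 => hGD _ _ β h₁ h₂ h0) hβ₁ hβ
  rw [← Real.rpow_natCast, ← Real.rpow_mul hcn.le, ← Real.rpow_neg hcn.le]
  norm_num

end BipartiteSpinGlass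

theorem mainTheorem11 (α : ℝ) (hα : α ∈ Set.Ioo (0 : ℝ) 1) (N₁ N₂ : ℕ → ℕ)
    (hN₁ : Tendsto N₁ atTop atTop) (hN₂ : Tendsto N₂ atTop atTop)
    (hratio : Tendsto (fun n => (N₁ n : ℝ) / ((N₁ n : ℝ) + (N₂ n : ℝ))) atTop (𝓝 α))
    (β₁ β₂ : ℝ) (hβ₁ : 0 ≤ β₁) (hβ : β₁ ≤ β₂) :
    Tendsto (fun n => ∫ β in β₁..β₂,
        |avgQP12QP23 (N₁ n) (N₂ n) β
          - (1 / 2 * avgQPsq (N₁ n) (N₂ n) β + 1 / 2 * avgQP (N₁ n) (N₂ n) β ^ 2)|)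
      atTop (𝓝 0) ∧
    Tendsto (fun n => ∫ β in β₁..β₂,
        |avgQP12QP34 (N₁ n) (N₂ n) β
          - (1 / 3 * avgQPsq (N₁ n) (N₂ n) β + 2 / 3 * avgQP (N₁ n) (N₂ n) β ^ 2)|)
      atTop (𝓝 0) :=
  ⟨tendsto_intervalIntegral_defect hα.1 hN₁ hN₂ hratio hβ₁ hβ (G := defect23)
      (fun _ _ β => (abs_defect_le β).1) fun _ _ _ h₁ h₂ h => (defect_le_energyDeviation h₁ h₂ h).1,
    tendsto_intervalIntegral_defect hα.1 hN₁ hN₂ hratio hβ₁ hβ (G := defect34)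
      (fun _ _ β => (abs_defect_le β).2) fun _ _ _ h₁ h₂ h => (defect_le_energyDeviation h₁ h₂ h).2⟩
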